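/- Let $n\ge 0$. A composition of $n$ is a finitely supported family $\nu=(\nu_j)_{j\in\mathbb Z}$ of non-negative integers with sum $n$; its $j$th block is the set of positions $p\in\{1,\dots,n\}$ with $\sum_{h<j}\nu_h<p\le\sum_{h\le j}\nu_h$, and $S_\nu\le S_n$ is the subgroup preserving every block. Let $C$ be the quotient of $\mathbb C[x_1,\dots,x_n]$ by the ideal generated by all homogeneous symmetric polynomials of positive degree, with its natural $S_n$-action, and put $C_\nu:=C^{S_\nu}$. Let $e_r(\nu;j),h_r(\nu;j)\in C_\nu$ be the images of the $r$th elementary and complete symmetric polynomials in the variables of the $j$th block of $\nu$ (zero for $r<0$). Let $\hat{\mathfrak g}=\mathfrak{gl}_\infty(\mathbb C)$ be the Lie algebra of $\mathbb Z\times\mathbb Z$-matrices with finitely many non-zero entries, let $E_i$ and $F_i$ be its $(i,i+1)$- and $(i+1,i)$-matrix units, and let $\widehat V$ be its natural module with basis $(v_j)_{j\in\mathbb Z}$. Let $\widetilde C$ be $C$ with the $S_n$-action twisted by sign. Put $\varepsilon_\nu:=|S_\nu|^{-1}\prod(x_p-x_q)$, the product over all $p<q$ in the same block of $\nu$. Then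 there is a linear isomorphism $\varphi:\widehat V^{\otimes n}\otimes_{\mathbb CS_n}\widetilde C\to\bigoplus_\nu C_\nu$ (sum over all compositions of $n$) such that $\varphi^{-1}(z)=(v_{a_1}\otimes\cdots\otimes v_{a_n})\otimes\varepsilon_\nu z$ for $z\in C_\nu$, where $a_1\le\dots\le a_n$ and exactly $\nu_j$ of the $a_p$ equal $j$ for each $j$. Transport the natural action of $\hat{\mathfrak g}$ along $\varphi$ to an action on $\bigoplus_\nu C_\nu$. Fix $i\in\mathbb Z$ and a composition $\nu$ of $n$ with $\nu_i\ne0$. Let $\nu'$ be obtained from $\nu$ by replacing $\nu_i$ by $\nu_i-1$ and $\nu_{i+1}$ by $\nu_{i+1}+1$. Put $a:=\nu'_i$, $b:=\nu_{i+1}$, $k:=\sum_{j\le i}\nu_j$. Write $C_{\nu,\nu'}$ and $C_{\nu',\nu}$ for the algebra $C^{S_\nu\cap S_{\nu'}}$ regarded as a $(C_\nu,C_{\nu'})$-bimodule and as a $(C_{\nu'},C_\nu)$-bimodule, respectively, and $A\text{-mod}$ for the category of finite dimensional left $A$-modules. (1) There is a unique adjunction making $(C_{\nu,\nu'}\otimes_{C_{\nu'}}?,\;C_{\nu',\nu}\otimes_{C_\nu}?)$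 an adjoint pair of functors between $C_{\nu'}\text{-mod}$ and $C_\nu\text{-mod}$ whose unit $\iota'$ and counit $\varepsilon$ are given, for all modules $M$, $m\in M$ and $r,s\ge0$, by $$\iota'(m)=(-1)^a\sum_{r=0}^a(-1)^re_r(\nu';i)\otimes x_k^{a-r}\otimes m,\qquad \varepsilon(x_k^r\otimes x_k^s\otimes m)=(-1)^ah_{r+s-a}(\nu;i)\,m.$$ There is a unique adjunction making $(C_{\nu',\nu}\otimes_{C_\nu}?,\;C_{\nu,\nu'}\otimes_{C_{\nu'}}?)$ an adjoint pair whose unit $\iota$ and counit $\varepsilon'$ are given by $$\iota(m)=\sum_{r=0}^b(-1)^re_r(\nu;i+1)\otimes x_k^{b-r}\otimes m,\qquad \varepsilon'(x_k^r\otimes x_k^s\otimes m)=h_{r+s-b}(\nu';i+1)\,m.$$ (2) Identify the centre $Z(A\text{-mod})$ (the ring of endomorphisms of the identity functor) with $A$, for $A=C_\nu$ and $A=C_{\nu'}$, through the isomorphism that sends $z \in A$ to multiplication by $z$. Then the trace maps $C_{\nu'}\to C_\nu$ and $C_\nu\to C_{\nu'}$ defined by $$z'\mapsto\varepsilon\circ(\mathbf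 1_{C_{\nu,\nu'}\otimes_{C_{\nu'}}?}\;z'\;\mathbf 1_{C_{\nu',\nu}\otimes_{C_\nu}?})\circ\iota,\qquad z\mapsto\varepsilon'\circ(\mathbf 1_{C_{\nu',\nu}\otimes_{C_\nu}?}\;z\;\mathbf 1_{C_{\nu,\nu'}\otimes_{C_{\nu'}}?})\circ\iota'$$ are equal to the maps $C_{\nu'}\to C_\nu$ and $C_\nu\to C_{\nu'}$ given by the action of the Chevalley generators $E_i$ and $F_i$ of $\hat{\mathfrak g}$ on $\bigoplus_\nu C_\nu$, respectively. -/

import Mathlib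

open CategoryTheory TensorProduct DirectSum

noncomputable section

namespace TraceMaps

/-! ### Compositions, blocks and parabolic subgroups -/

/-- Compositions of `n` indexed by `ℤ`: finitely supported families `(ν_i)_{i ∈ ℤ}` of
non-negative integers with sum `n`. -/
abbrev Comp (n : ℕ) : Type := {ν : ℤ →₀ ℕ // ν.degree = n}

variable {n : ℕ}

/-- The partial sum `∑_{h ≤ i} ν_h`. -/
def psum (ν : Comp n) (i : ℤ) : ℕ := ∑ h ∈ ν.1.support with h ≤ i, ν.1 h

/-- `colour ν p` is the index of the block of `ν` that contains the position `p`. Positions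
`1, …, n` are numbered `0, …, n - 1` here, so this is the least `i` with
`p < ∑_{h ≤ i} ν_h`. The sequence `colour ν 0 ≤ colour ν 1 ≤ ⋯` is the weakly increasing
sequence in which each integer `i` occurs exactly `ν_i` times. -/
def colour (ν : Comp n) (p : Fin n) : ℤ := sInf {i : ℤ | (p : ℕ) < psum ν i}

lemma psum_mono (ν : Comp n) : Monotone (psum ν) := by
  intro i j hij
  refine Finset.sum_le_sum_of_subset ?_
  intro h hh
  simp only [Finset.mem_filter] at hh ⊢
  exact ⟨hh.1, hh.2.trans hij⟩

lemma psum_le (ν : Comp n) (i : ℤ) : psum ν i ≤ n := by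
  have h := ν.2
  rw [Finsupp.degree_apply] at h
  calc psum ν i ≤ ∑ h ∈ ν.1.support, ν.1 h :=
        Finset.sum_le_sum_of_subset (Finset.filter_subset _ _)
    _ = n := h

lemma exists_psum_eq (ν : Comp n) : ∃ i, psum ν i = n := by
  obtain ⟨b, hb⟩ := ν.1.support.bddAbove
  refine ⟨b, ?_⟩
  have h := ν.2
  rw [Finsupp.degree_apply] at h
  rw [psum, Finset.filter_true_of_mem (fun x hx => hb hx), h]

lemma exists_psum_eq_zero (ν : Comp n) : ∃ i, psum ν i = 0 := by
  obtain ⟨b, hb⟩ := ν.1.support.bddBelow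
  refine ⟨b - 1, ?_⟩
  rw [psum, Finset.filter_false_of_mem, Finset.sum_empty]
  intro x hx
  have : b ≤ x := hb hx
  omega

/-- The block of colour `i` is the interval `∑_{h < i} ν_h < j ≤ ∑_{h ≤ i} ν_h`
(for positions `j = p + 1`). -/
lemma colour_eq_iff (ν : Comp n) (p : Fin n) (i : ℤ) :
    colour ν p = i ↔ psum ν (i - 1) ≤ (p : ℕ) ∧ (p : ℕ) < psum ν i := by
  have hne : {i : ℤ | (p : ℕ) < psum ν i}.Nonempty := by
    obtain ⟨j, hj⟩ := exists_psum_eq ν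
    exact ⟨j, by simp [hj, p.2]⟩
  have hbd : BddBelow {i : ℤ | (p : ℕ) < psum ν i} := by
    obtain ⟨j, hj⟩ := exists_psum_eq_zero ν
    refine ⟨j, fun x hx => ?_⟩
    by_contra hlt
    have h1 := psum_mono ν (not_le.mp hlt).le
    have h2 : (p : ℕ) < psum ν x := hx
    omega
  constructor
  · rintro rfl
    refine ⟨?_, Int.csInf_mem hne hbd⟩
    by_contra hlt
    have h1 : colour ν p ≤ colour ν p - 1 := csInf_le hbd (not_le.mp hlt)
    omega
  · rintro ⟨h1, h2⟩
    refine le_antisymm (csInf_le hbd h2) (le_csInf hne fun x hx => ?_)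
    by_contra hlt
    have h3 : x ≤ i - 1 := by omega
    have h4 := psum_mono ν h3
    have h5 : (p : ℕ) < psum ν x := hx
    omega

lemma psum_eq_sum (ν : Comp n) (i : ℤ) {s : Finset ℤ} (hs : ν.1.support ⊆ s) :
    psum ν i = ∑ h ∈ s with h ≤ i, ν.1 h := by
  refine Finset.sum_subset (Finset.filter_subset_filter _ hs) fun x hx hx' => ?_
  simp only [Finset.mem_filter, not_and] at hx hx'
  exact Finsupp.notMem_support_iff.mp fun h => hx' h hx.2

lemma psum_eq_add (ν : Comp n) (i : ℤ) : psum ν i = psum ν (i - 1) + ν.1 i := by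
  have hs : ν.1.support ⊆ insert i ν.1.support := Finset.subset_insert _ _
  rw [psum_eq_sum ν i hs, psum_eq_sum ν (i - 1) hs, add_comm]
  have h : (insert i ν.1.support).filter (· ≤ i) =
      insert i ((insert i ν.1.support).filter (· ≤ i - 1)) := by
    ext x
    simp only [Finset.mem_filter, Finset.mem_insert]
    constructor
    · rintro ⟨h1, h2⟩
      rcases eq_or_ne x i with h3 | h3
      · exact Or.inl h3
      · exact Or.inr ⟨h1, by omega⟩
    · rintro (h1 | ⟨h1, h2⟩)
      · exact ⟨Or.inl h1, h1.le⟩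
      · exact ⟨h1, by omega⟩
  rw [h, Finset.sum_insert]
  simp

/-- The parabolic subgroup `S_ν` of the symmetric group. -/
def parabolic (ν : Comp n) : Subgroup (Equiv.Perm (Fin n)) where
  carrier := {w | ∀ p, colour ν (w p) = colour ν p}
  mul_mem' {u v} hu hv p := by
    rw [Equiv.Perm.mul_apply, hu, hv]
  one_mem' _ := rfl
  inv_mem' {u} hu p := by
    rw [← hu (u⁻¹ p)]
    simp

/-! ### The coinvariant algebra and its invariants -/

/-- The ideal of `ℂ[x_1, …, x_n]` generated by all homogeneous symmetric polynomials of positive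
degree. -/
def symIdeal (n : ℕ) : Ideal (MvPolynomial (Fin n) ℂ) :=
  Ideal.span {f | f.IsSymmetric ∧ ∃ d : ℕ, 0 < d ∧ f.IsHomogeneous d}

/-- The coinvariant algebra `C`. -/
def Coinv (n : ℕ) : Type := MvPolynomial (Fin n) ℂ ⧸ symIdeal n

instance (n : ℕ) : CommRing (Coinv n) := inferInstanceAs (CommRing (_ ⧸ symIdeal n))

instance (n : ℕ) : Algebra ℂ (Coinv n) := inferInstanceAs (Algebra ℂ (_ ⧸ symIdeal n))

/-- The quotient map from polynomials to the coinvariant algebra. -/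
def toCoinv (n : ℕ) : MvPolynomial (Fin n) ℂ →ₐ[ℂ] Coinv n :=
  Ideal.Quotient.mkₐ ℂ (symIdeal n)

lemma symIdeal_le_comap (w : Equiv.Perm (Fin n)) :
    symIdeal n ≤ (symIdeal n).comap (MvPolynomial.rename (R := ℂ) w) := by
  refine Ideal.span_le.mpr ?_
  rintro f ⟨hf, d, hd, hfd⟩
  refine Ideal.subset_span ?_
  have h : MvPolynomial.rename (R := ℂ) w f = f := hf w
  change MvPolynomial.rename (R := ℂ) w f ∈ _
  rw [h]
  exact ⟨hf, d, hd, hfd⟩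

/-- The action of a permutation `w` on `C`, induced by `x_j ↦ x_{w j}`. -/
def perm (w : Equiv.Perm (Fin n)) : Coinv n →ₐ[ℂ] Coinv n :=
  Ideal.quotientMapₐ (symIdeal n) (MvPolynomial.rename w) (symIdeal_le_comap w)

@[simp] lemma perm_toCoinv (w : Equiv.Perm (Fin n)) (f : MvPolynomial (Fin n) ℂ) :
    perm w (toCoinv n f) = toCoinv n (MvPolynomial.rename w f) := rfl

/-- The algebra `C^G` of `G`-invariants in `C`. -/
def inv (G : Subgroup (Equiv.Perm (Fin n))) : Subalgebra ℂ (Coinv n) where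
  carrier := {c | ∀ w ∈ G, perm w c = c}
  mul_mem' {c d} hc hd w hw := by rw [map_mul, hc w hw, hd w hw]
  add_mem' {c d} hc hd w hw := by rw [map_add, hc w hw, hd w hw]
  algebraMap_mem' r w _ := (perm w).commutes r

lemma inv_anti {G H : Subgroup (Equiv.Perm (Fin n))} (h : G ≤ H) : inv H ≤ inv G :=
  fun _ hc w hw => hc w (h hw)

/-- The partial coinvariant algebra `C_ν = C^{S_ν}`. -/
def PCoinv (ν : Comp n) : Type := ↥(inv (parabolic ν))

/-- The algebra `C_{ν,ν'} = C^{S_ν ∩ S_{ν'}}`, which contains `C_ν` and `C_{ν'}`. The bimodules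
`C_{ν,ν'}` and `C_{ν',ν}` are both this algebra, `C_ν` and `C_{ν'}` acting by multiplication. -/
def JCoinv (ν ν' : Comp n) : Type := ↥(inv (parabolic ν ⊓ parabolic ν'))

section Instances

variable (ν ν' : Comp n)

instance : CommRing (PCoinv ν) := inferInstanceAs (CommRing (inv (parabolic ν)))

instance : Algebra ℂ (PCoinv ν) := inferInstanceAs (Algebra ℂ (inv (parabolic ν)))

instance : CommRing (JCoinv ν ν') := inferInstanceAs (CommRing (inv (parabolic ν ⊓ parabolic ν')))

instance : Algebra ℂ (JCoinv ν ν') :=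
  inferInstanceAs (Algebra ℂ (inv (parabolic ν ⊓ parabolic ν')))

/-- The inclusion of `C_ν` into `C`. -/
def PCoinv.val : PCoinv ν →ₐ[ℂ] Coinv n := (inv (parabolic ν)).val

/-- The inclusion of `C_ν` into `C_{ν,ν'}`. -/
def inclLeft : PCoinv ν →ₐ[ℂ] JCoinv ν ν' := Subalgebra.inclusion (inv_anti inf_le_left)

/-- The inclusion of `C_{ν'}` into `C_{ν,ν'}`. -/
def inclRight : PCoinv ν' →ₐ[ℂ] JCoinv ν ν' := Subalgebra.inclusion (inv_anti inf_le_right)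

instance algebraLeft : Algebra (PCoinv ν) (JCoinv ν ν') := (inclLeft ν ν').toRingHom.toAlgebra

instance algebraRight : Algebra (PCoinv ν') (JCoinv ν ν') := (inclRight ν ν').toRingHom.toAlgebra

instance smulCommLR : SMulCommClass (PCoinv ν) (PCoinv ν') (JCoinv ν ν') where
  smul_comm a b d := by
    rw [Algebra.smul_def, Algebra.smul_def, Algebra.smul_def, Algebra.smul_def]
    ring

instance smulCommRL : SMulCommClass (PCoinv ν') (PCoinv ν) (JCoinv ν ν') :=
  SMulCommClass.symm _ _ _

instance towerLeft : IsScalarTower ℂ (PCoinv ν) (JCoinv ν ν') :=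
  IsScalarTower.of_algebraMap_eq' (inclLeft ν ν').comp_algebraMap.symm

instance towerRight : IsScalarTower ℂ (PCoinv ν') (JCoinv ν ν') :=
  IsScalarTower.of_algebraMap_eq' (inclRight ν ν').comp_algebraMap.symm

end Instances

lemma toCoinv_X_pow (p : Fin n) : toCoinv n (MvPolynomial.X p) ^ n = 0 := by
  have key := MvPolynomial.prod_C_add_X_eq_sum_esymm ℂ (Fin n)
  have h := congrArg (Polynomial.eval (-(MvPolynomial.X p : MvPolynomial (Fin n) ℂ))) key
  rw [Polynomial.eval_prod, Finset.prod_eq_zero (Finset.mem_univ p) (by simp),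
    Polynomial.eval_finsetSum] at h
  have h2 := congrArg (toCoinv n) h
  rw [map_zero, map_sum, Finset.sum_range_succ'] at h2
  rw [Finset.sum_eq_zero] at h2
  · simp only [Fintype.card_fin, MvPolynomial.esymm_zero, map_one, one_mul, zero_add, Nat.sub_zero,
      Polynomial.eval_pow, Polynomial.eval_X, map_pow, map_neg] at h2
    rw [← neg_neg (toCoinv n (MvPolynomial.X p)), neg_pow, ← h2, mul_zero]
  · intro d _
    rw [Polynomial.eval_mul, Polynomial.eval_C, map_mul]
    have : toCoinv n (MvPolynomial.esymm (Fin n) ℂ (d + 1)) = 0 := by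
      refine Ideal.Quotient.eq_zero_iff_mem.mpr (Ideal.subset_span ?_)
      exact ⟨MvPolynomial.esymm_isSymmetric _ _ _, d + 1, Nat.succ_pos _,
        by
          rw [MvPolynomial.esymm]
          refine MvPolynomial.IsHomogeneous.sum _ _ _ fun t ht => ?_
          rw [← (Finset.mem_powersetCard.mp ht).2, Finset.card_eq_sum_ones]
          exact MvPolynomial.IsHomogeneous.prod _ _ _ fun p _ => MvPolynomial.isHomogeneous_X _ _⟩
    rw [this, zero_mul]

/-- `C` is finite dimensional, because it is generated by the nilpotent elements `x_j`. -/
instance finiteCoinv (n : ℕ) : Module.Finite ℂ (Coinv n) := by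
  have hint : Algebra.IsIntegral ℂ (Coinv n) := by
    refine ⟨fun c => ?_⟩
    obtain ⟨f, rfl⟩ := Ideal.Quotient.mk_surjective c
    change IsIntegral ℂ (toCoinv n f)
    induction f using MvPolynomial.induction_on with
    | C a => exact isIntegral_algebraMap (R := ℂ) (A := Coinv n) (x := a)
    | add f g hf hg => rw [map_add]; exact hf.add hg
    | mul_X f p hf =>
      rw [map_mul]
      refine hf.mul ⟨Polynomial.X ^ n, Polynomial.monic_X_pow n, ?_⟩
      simpa using toCoinv_X_pow p
  have hft : Algebra.FiniteType ℂ (Coinv n) :=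
    Algebra.FiniteType.of_surjective (toCoinv n) Ideal.Quotient.mk_surjective
  exact Algebra.IsIntegral.finite

instance (ν ν' : Comp n) : Module.Finite ℂ (JCoinv ν ν') :=
  inferInstanceAs (Module.Finite ℂ (inv (parabolic ν ⊓ parabolic ν')))

instance finiteLeft (ν ν' : Comp n) : Module.Finite (PCoinv ν) (JCoinv ν ν') :=
  Module.Finite.of_restrictScalars_finite ℂ _ _

instance finiteRight (ν ν' : Comp n) : Module.Finite (PCoinv ν') (JCoinv ν ν') :=
  Module.Finite.of_restrictScalars_finite ℂ _ _

/-! ### Symmetric functions in a block of variables -/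

lemma rename_block_eq (ν : Comp n) (i : ℤ) (f : MvPolynomial {p : Fin n // colour ν p = i} ℂ)
    (hf : f.IsSymmetric) {w : Equiv.Perm (Fin n)} (hw : w ∈ parabolic ν) :
    MvPolynomial.rename w (MvPolynomial.rename Subtype.val f) =
      MvPolynomial.rename Subtype.val f := by
  have h : ∀ p, colour ν p = i ↔ colour ν (w p) = i := fun p => by rw [hw p]
  have h2 := hf (w.subtypePerm fun p => (h p).symm)
  conv_rhs => rw [← h2]
  rw [MvPolynomial.rename_rename, MvPolynomial.rename_rename]
  rfl

/-- `e_r(ν;i) ∈ C_ν`: the `r`th elementary symmetric polynomial in the variables of the `i`th block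
of `ν`. -/
def e (ν : Comp n) (r : ℕ) (i : ℤ) : PCoinv ν :=
  ⟨toCoinv n (MvPolynomial.rename Subtype.val
      (MvPolynomial.esymm {p : Fin n // colour ν p = i} ℂ r)), fun w hw => by
    rw [perm_toCoinv, rename_block_eq ν i _ (MvPolynomial.esymm_isSymmetric _ _ _) hw]⟩

/-- `h_r(ν;i) ∈ C_ν`: the `r`th complete symmetric polynomial in the variables of the `i`th block
of `ν`; it is zero for `r < 0`. -/
def h (ν : Comp n) (r : ℤ) (i : ℤ) : PCoinv ν :=
  if r < 0 then 0 else
  ⟨toCoinv n (MvPolynomial.rename Subtype.val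
      (MvPolynomial.hsymm {p : Fin n // colour ν p = i} ℂ r.toNat)), fun w hw => by
    rw [perm_toCoinv, rename_block_eq ν i _ (MvPolynomial.hsymm_isSymmetric _ _ _) hw]⟩

/-! ### The key situation -/

/-- `ν_i ≠ 0`, and `ν'` is obtained from `ν` by replacing `ν_i` by `ν_i - 1` and `ν_{i+1}` by
`ν_{i+1} + 1`. -/
def KeySituation (ν ν' : Comp n) (i : ℤ) : Prop :=
  ν.1 i ≠ 0 ∧ ν'.1 = ν.1 - Finsupp.single i 1 + Finsupp.single (i + 1) 1

section Key

variable {ν ν' : Comp n} {i : ℤ}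

/-- The position `k = ∑_{j ≤ i} ν_j`, numbered from `0`. -/
def KeySituation.k (hk : KeySituation ν ν' i) : Fin n :=
  ⟨psum ν i - 1, by
    have h1 := psum_eq_add ν i
    have h2 := psum_le ν i
    have h3 := hk.1
    omega⟩

lemma KeySituation.apply (hk : KeySituation ν ν' i) (j : ℤ) :
    ν'.1 j = ν.1 j - (if j = i then 1 else 0) + (if j = i + 1 then 1 else 0) := by
  rw [hk.2]
  simp [Finsupp.single_apply, eq_comm]

lemma KeySituation.psum_lt (hk : KeySituation ν ν' i) {j : ℤ} (hj : j < i) :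
    psum ν' j = psum ν j := by
  rw [psum_eq_sum ν j (s := ν.1.support ∪ ν'.1.support) Finset.subset_union_left,
    psum_eq_sum ν' j (s := ν.1.support ∪ ν'.1.support) Finset.subset_union_right]
  refine Finset.sum_congr rfl fun x hx => ?_
  have hx' : x ≤ j := (Finset.mem_filter.mp hx).2
  rw [hk.apply, if_neg (by omega), if_neg (by omega)]
  rfl

lemma KeySituation.psum_self (hk : KeySituation ν ν' i) : psum ν' i = psum ν i - 1 := by
  have h1 := psum_eq_add ν i
  have h2 := psum_eq_add ν' i
  have h3 := hk.apply i
  have h4 := hk.psum_lt (j := i - 1) (by omega)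
  have h5 := hk.1
  rw [if_pos rfl, if_neg (by omega)] at h3
  omega

lemma KeySituation.psum_succ (hk : KeySituation ν ν' i) : psum ν' (i + 1) = psum ν (i + 1) := by
  have h1 := psum_eq_add ν (i + 1)
  have h2 := psum_eq_add ν' (i + 1)
  have h3 := hk.apply (i + 1)
  have h4 := hk.psum_self
  have h5 := hk.1
  have h6 := psum_eq_add ν i
  rw [if_neg (by omega), if_pos rfl] at h3
  rw [add_sub_cancel_right] at h1 h2
  omega

/-- The position `k` is the only one in the `i`th block of `ν` and the `(i+1)`st block of `ν'`. -/
lemma KeySituation.eq_k_iff (hk : KeySituation ν ν' i) (p : Fin n) :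
    p = hk.k ↔ colour ν p = i ∧ colour ν' p = i + 1 := by
  rw [colour_eq_iff, colour_eq_iff, add_sub_cancel_right, hk.psum_self, hk.psum_succ]
  have h1 := psum_mono ν (show i ≤ i + 1 by omega)
  have h2 := psum_eq_add ν i
  have h3 := hk.1
  have h4 : (hk.k : ℕ) = psum ν i - 1 := rfl
  rw [Fin.ext_iff, h4]
  omega

/-- The element `x_k` of `C_{ν,ν'}`. -/
def KeySituation.x (hk : KeySituation ν ν' i) : JCoinv ν ν' :=
  ⟨toCoinv n (MvPolynomial.X hk.k), fun w hw => by
    have h1 := (hk.eq_k_iff hk.k).mp rfl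
    have h2 : w hk.k = hk.k := by
      rw [hk.eq_k_iff, hw.1, hw.2]
      exact h1
    rw [perm_toCoinv, MvPolynomial.rename_X, h2]⟩

end Key

/-! ### Tensoring with a bimodule, centres and trace maps -/

section General

/-- The functor `D ⊗_A ?` from finitely generated `A`-modules to finitely generated `B`-modules,
where the commutative ring `D` is regarded as a `(B, A)`-bimodule. If `A` and `B` are finite
dimensional `ℂ`-algebras, finitely generated means the same as finite dimensional. -/
def tensorFunctor (A B D : Type) [CommRing A] [CommRing B] [CommRing D] [Algebra A D]
    [Algebra B D] [SMulCommClass A B D] [Module.Finite B D] :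
    FGModuleCat.{0} A ⥤ FGModuleCat.{0} B where
  obj M :=
    haveI : Module.Finite B (D ⊗[A] M) := Module.Finite.trans D _
    FGModuleCat.of B (D ⊗[A] M)
  map {M N} f :=
    haveI : Module.Finite B (D ⊗[A] M) := Module.Finite.trans D _
    haveI : Module.Finite B (D ⊗[A] N) := Module.Finite.trans D _
    FGModuleCat.ofHom ((TensorProduct.AlgebraTensorModule.map (LinearMap.id : D →ₗ[D] D)
      f.hom.hom).restrictScalars B)
  map_id M := by
    refine FGModuleCat.hom_ext (LinearMap.ext fun x => ?_)
    exact congrArg (fun g : D ⊗[A] M →ₗ[D] D ⊗[A] M => g x) TensorProduct.AlgebraTensorModule.map_id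
  map_comp {M N K} f g := by
    refine FGModuleCat.hom_ext (LinearMap.ext fun x => ?_)
    exact congrArg (fun g : D ⊗[A] M →ₗ[D] D ⊗[A] K => g x)
      (TensorProduct.AlgebraTensorModule.map_comp (LinearMap.id : D →ₗ[D] D)
        (LinearMap.id : D →ₗ[D] D) g.hom.hom f.hom.hom)

/-- The canonical isomorphism from a commutative ring `A` to the centre of the category of finitely
generated `A`-modules: `a` goes to multiplication by `a`. -/
def centreEquiv (A : Type) [CommRing A] : A ≃+* CatCenter (FGModuleCat.{0} A) :=
  RingEquiv.ofBijective (Linear.toCatCenter A (FGModuleCat.{0} A)) (by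
    constructor
    · intro a b hab
      have h1 := congrArg (fun z : CatCenter (FGModuleCat.{0} A) =>
        (z.app (FGModuleCat.of A A)).hom.hom (1 : A)) hab
      have h2 : a * 1 = b * 1 := h1
      simpa using h2
    · intro z
      refine ⟨(z.app (FGModuleCat.of A A)).hom.hom (1 : A), ?_⟩
      ext M m
      have h1 := z.naturality (FGModuleCat.ofHom (LinearMap.toSpanSingleton A M m))
      have h2 := congrArg (fun f : FGModuleCat.of A A ⟶ FGModuleCat.of A M => f.hom.hom (1 : A)) h1
      have h3 : (z.app M).hom.hom ((1 : A) • m) =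
        (z.app (FGModuleCat.of A A)).hom.hom (1 : A) • m := h2
      rw [one_smul] at h3
      exact h3.symm)

/-- The trace map on centres attached to functors `L : 𝒜 ⥤ ℬ` and `R : ℬ ⥤ 𝒜` that are adjoint to
each other on both sides: it sends `z` to `ε ∘ (1_R z 1_L) ∘ ι`, where `ι` is the unit of the
adjunction `L ⊣ R` and `ε` is the counit of the adjunction `R ⊣ L`. -/
def trace {𝒜 ℬ : Type*} [Category* 𝒜] [Category* ℬ] {L : 𝒜 ⥤ ℬ} {R : ℬ ⥤ 𝒜}
    (adj₁ : L ⊣ R) (adj₂ : R ⊣ L) (z : CatCenter ℬ) : CatCenter 𝒜 where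
  app M := adj₁.unit.app M ≫ R.map (z.app (L.obj M)) ≫ adj₂.counit.app M
  naturality M N f := by
    have h1 := adj₁.unit.naturality f
    have h2 := adj₂.counit.naturality f
    have h3 := z.naturality (L.map f)
    simp only [Functor.id_map, Functor.comp_map, Functor.id_obj, Functor.comp_obj] at h1 h2 h3 ⊢
    rw [reassoc_of% h1, Category.assoc, Category.assoc, ← h2, ← R.map_comp_assoc, h3,
      R.map_comp_assoc]

end General

/-! ### The Lie algebra `gl_∞` and its action on tensor space -/

attribute [local instance 100] LieRing.ofAssociativeRing

/-- The natural module `V̂` with basis `(v_i)_{i ∈ ℤ}`. -/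
def NatMod : Type := ℤ →₀ ℂ

instance : AddCommGroup NatMod := inferInstanceAs (AddCommGroup (ℤ →₀ ℂ))

instance : Module ℂ NatMod := inferInstanceAs (Module ℂ (ℤ →₀ ℂ))

/-- The basis `(v_i)_{i ∈ ℤ}` of `V̂`. -/
def natBasis : Module.Basis ℤ ℂ NatMod := ⟨LinearEquiv.refl ℂ (ℤ →₀ ℂ)⟩

/-- The basis vector `v_i`. -/
def v (i : ℤ) : NatMod := natBasis i

/-- The `(p, q)`-matrix unit, sending `v_q` to `v_p` and the other basis vectors to zero. -/
def unit (p q : ℤ) : Module.End ℂ NatMod := natBasis.constr ℂ fun t => if t = q then v p else 0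

lemma unit_v (p q t : ℤ) : unit p q (v t) = if t = q then v p else 0 :=
  natBasis.constr_basis ℂ _ t

lemma unit_mul_unit (p q r s : ℤ) : unit p q * unit r s = if q = r then unit p s else 0 := by
  refine natBasis.ext fun t => ?_
  change unit p q (unit r s (v t)) = (if q = r then unit p s else 0) (v t)
  rw [unit_v]
  by_cases h1 : t = s <;> by_cases h2 : q = r <;> simp [unit_v, h1, h2, eq_comm]

/-- `gl_∞(ℂ)`: the Lie algebra of matrices with rows and columns indexed by `ℤ`, all but finitely
many of whose entries are zero. Such a matrix is identified with the endomorphism of `V̂` that it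
defines. -/
def glInf : LieSubalgebra ℂ (Module.End ℂ NatMod) where
  toSubmodule := Submodule.span ℂ (Set.range fun pq : ℤ × ℤ => unit pq.1 pq.2)
  lie_mem' {X Y} hX hY := by
    have hmul : ∀ X ∈ Submodule.span ℂ (Set.range fun pq : ℤ × ℤ => unit pq.1 pq.2),
        ∀ Y ∈ Submodule.span ℂ (Set.range fun pq : ℤ × ℤ => unit pq.1 pq.2),
        X * Y ∈ Submodule.span ℂ (Set.range fun pq : ℤ × ℤ => unit pq.1 pq.2) := by
      intro X hX Y hY
      have h := Submodule.mul_mem_mul hX hY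
      rw [Submodule.span_mul_span] at h
      refine Submodule.span_le.mpr ?_ h
      rintro _ ⟨_, ⟨⟨p, q⟩, rfl⟩, _, ⟨⟨r, s⟩, rfl⟩, rfl⟩
      simp only [unit_mul_unit]
      split_ifs
      · exact Submodule.subset_span ⟨(p, s), rfl⟩
      · exact Submodule.zero_mem _
    rw [Ring.lie_def]
    exact Submodule.sub_mem _ (hmul X hX Y hY) (hmul Y hY X hX)

/-- The Chevalley generator `E_i`, the `(i, i+1)`-matrix unit. -/
def chevE (i : ℤ) : glInf := ⟨unit i (i + 1), Submodule.subset_span ⟨(i, i + 1), rfl⟩⟩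

/-- The Chevalley generator `F_i`, the `(i+1, i)`-matrix unit. -/
def chevF (i : ℤ) : glInf := ⟨unit (i + 1) i, Submodule.subset_span ⟨(i + 1, i), rfl⟩⟩

/-- The tensor power `V̂^{⊗ n}`. -/
abbrev TensorPow (n : ℕ) : Type := ⨂[ℂ] _ : Fin n, NatMod

/-- An endomorphism `X` of `V̂` applied to the tensor factor in position `p`. -/
def actAt (p : Fin n) (X : Module.End ℂ NatMod) : Module.End ℂ (TensorPow n) :=
  PiTensorProduct.map (Function.update (fun _ => (1 : Module.End ℂ NatMod)) p X)

lemma actAt_mul (p : Fin n) (X Y : Module.End ℂ NatMod) :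
    actAt p X * actAt p Y = actAt p (X * Y) := by
  rw [actAt, actAt, actAt, ← PiTensorProduct.map_mul]
  congr 1
  ext1 q
  by_cases h : q = p
  · subst h; simp
  · simp [Function.update_of_ne h]

lemma actAt_comm {p q : Fin n} (hpq : p ≠ q) (X Y : Module.End ℂ NatMod) :
    actAt p X * actAt q Y = actAt q Y * actAt p X := by
  rw [actAt, actAt, ← PiTensorProduct.map_mul, ← PiTensorProduct.map_mul]
  congr 1
  ext1 r
  by_cases h : r = p
  · subst h; simp [Function.update_of_ne hpq]
  · simp [Function.update_of_ne h]

lemma actAt_tprod (p : Fin n) (X : Module.End ℂ NatMod) (u : Fin n → NatMod) :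
    actAt p X (PiTensorProduct.tprod ℂ u) =
      PiTensorProduct.tprod ℂ (Function.update u p (X (u p))) := by
  rw [actAt, PiTensorProduct.map_tprod]
  congr 1
  ext1 q
  by_cases h : q = p
  · subst h; simp
  · simp [Function.update_of_ne h]

/-- The action of endomorphisms of `V̂` on `V̂^{⊗ n}`, as a representation of a Lie algebra:
`X (u_1 ⊗ ⋯ ⊗ u_n) = ∑_p u_1 ⊗ ⋯ ⊗ X u_p ⊗ ⋯ ⊗ u_n`. -/
def tensorRep (n : ℕ) : Module.End ℂ NatMod →ₗ⁅ℂ⁆ Module.End ℂ (TensorPow n) where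
  toFun X := ∑ p, actAt p X
  map_add' X Y := by
    rw [← Finset.sum_add_distrib]
    exact Finset.sum_congr rfl fun p _ => PiTensorProduct.map_update_add _ _ _ _
  map_smul' c X := by
    rw [RingHom.id_apply, Finset.smul_sum]
    exact Finset.sum_congr rfl fun p _ => PiTensorProduct.map_update_smul _ _ _ _
  map_lie' {X Y} := by
    have hsub : ∀ p : Fin n, actAt p (X * Y - Y * X) = actAt p (X * Y) - actAt p (Y * X) := by
      intro p
      rw [eq_sub_iff_add_eq, actAt, actAt, actAt, ← PiTensorProduct.map_update_add, sub_add_cancel]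
    simp only [Ring.lie_def, hsub, Finset.sum_sub_distrib, Finset.sum_mul_sum]
    rw [Finset.sum_comm (f := fun p q => actAt p Y * actAt q X), ← Finset.sum_sub_distrib,
      ← Finset.sum_sub_distrib]
    refine Finset.sum_congr rfl fun p _ => ?_
    rw [← Finset.sum_sub_distrib, Finset.sum_eq_single p]
    · rw [actAt_mul, actAt_mul]
    · intro q _ hq
      rw [actAt_comm hq.symm, sub_self]
    · simp

/-- The right action of permutations on `V̂^{⊗ n}`:
`(u_1 ⊗ ⋯ ⊗ u_n) w = u_{w 1} ⊗ ⋯ ⊗ u_{w n}`. -/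
def rightPerm (w : Equiv.Perm (Fin n)) : Module.End ℂ (TensorPow n) :=
  (PiTensorProduct.reindex ℂ (fun _ : Fin n => NatMod) w.symm).toLinearMap

lemma rightPerm_tprod (w : Equiv.Perm (Fin n)) (u : Fin n → NatMod) :
    rightPerm w (PiTensorProduct.tprod ℂ u) = PiTensorProduct.tprod ℂ (u ∘ w) :=
  PiTensorProduct.reindex_tprod _ _

lemma tensorRep_rightPerm (X : Module.End ℂ NatMod) (w : Equiv.Perm (Fin n)) (t : TensorPow n) :
    tensorRep n X (rightPerm w t) = rightPerm w (tensorRep n X t) := by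
  have h : tensorRep n X ∘ₗ rightPerm w = rightPerm w ∘ₗ tensorRep n X := by
    refine PiTensorProduct.ext (MultilinearMap.ext fun u => ?_)
    simp only [LinearMap.compMultilinearMap_apply, LinearMap.comp_apply, rightPerm_tprod]
    change (∑ p, actAt p X) _ = rightPerm w ((∑ p, actAt p X) _)
    simp only [LinearMap.sum_apply, map_sum, actAt_tprod, rightPerm_tprod]
    refine Fintype.sum_equiv w _ _ fun p => ?_
    congr 1
    rw [Function.update_comp_equiv]
    simp
  exact LinearMap.congr_fun h t

/-- The twisted action of a permutation `w` on `C`, giving the module `C̃`: the natural action times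
the sign of `w`. -/
def twist (w : Equiv.Perm (Fin n)) : Module.End ℂ (Coinv n) :=
  ((Equiv.Perm.sign w : ℤ) : ℂ) • (perm w).toLinearMap

/-- The subspace of `V̂^{⊗ n} ⊗_ℂ C̃` spanned by all `t w ⊗ c - t ⊗ w c`. -/
def relations (n : ℕ) : Submodule ℂ (TensorPow n ⊗[ℂ] Coinv n) :=
  Submodule.span ℂ {z | ∃ (w : Equiv.Perm (Fin n)) (t : TensorPow n) (c : Coinv n),
    z = rightPerm w t ⊗ₜ[ℂ] c - t ⊗ₜ[ℂ] twist w c}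

/-- The space `V̂^{⊗ n} ⊗_{ℂ S_n} C̃`. -/
abbrev SchurSpace (n : ℕ) : Type := (TensorPow n ⊗[ℂ] Coinv n) ⧸ relations n

lemma relations_le_comap (X : Module.End ℂ NatMod) :
    relations n ≤ (relations n).comap ((tensorRep n X).rTensor (Coinv n)) := by
  refine Submodule.span_le.mpr ?_
  rintro _ ⟨w, t, c, rfl⟩
  refine Submodule.subset_span ⟨w, tensorRep n X t, c, ?_⟩
  rw [map_sub, LinearMap.rTensor_tmul, LinearMap.rTensor_tmul, tensorRep_rightPerm]

/-- The action of `gl_∞` on `V̂^{⊗ n} ⊗_{ℂ S_n} C̃` through the first tensor factor. -/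
def schurRep (n : ℕ) : glInf →ₗ⁅ℂ⁆ Module.End ℂ (SchurSpace n) where
  toFun X := (relations n).mapQ (relations n) ((tensorRep n X).rTensor (Coinv n))
    (relations_le_comap X.1)
  map_add' X Y := by
    refine Submodule.linearMap_qext _ (LinearMap.ext fun z => ?_)
    simp [LinearMap.rTensor_add]
  map_smul' c X := by
    refine Submodule.linearMap_qext _ (LinearMap.ext fun z => ?_)
    simp [LinearMap.rTensor_smul]
  map_lie' {X Y} := by
    refine Submodule.linearMap_qext _ (TensorProduct.ext' fun t c => ?_)
    have h1 : tensorRep n ⁅X.1, Y.1⁆ t =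
        tensorRep n X.1 (tensorRep n Y.1 t) - tensorRep n Y.1 (tensorRep n X.1 t) := by
      rw [LieHom.map_lie]
      rfl
    change (relations n).mkQ (tensorRep n ⁅X.1, Y.1⁆ t ⊗ₜ[ℂ] c) =
      (relations n).mkQ (tensorRep n X.1 (tensorRep n Y.1 t) ⊗ₜ[ℂ] c) -
        (relations n).mkQ (tensorRep n Y.1 (tensorRep n X.1 t) ⊗ₜ[ℂ] c)
    rw [h1, TensorProduct.sub_tmul, map_sub]

/-! ### The action of `gl_∞` on the sum of the partial coinvariant algebras -/

/-- The direct sum of the algebras `C_ν` over all compositions `ν` of `n`. -/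
abbrev SumPCoinv (n : ℕ) : Type := ⨁ ν : Comp n, PCoinv ν

/-- The element `ε_ν = |S_ν|⁻¹ ∏ (x_p - x_q)` of `C`, the product over all `p < q` in the same block
of `ν`. -/
def eps (ν : Comp n) : Coinv n :=
  toCoinv n (MvPolynomial.C ((Nat.card (parabolic ν) : ℂ)⁻¹) *
    ∏ pq : Fin n × Fin n with pq.1 < pq.2 ∧ colour ν pq.1 = colour ν pq.2,
      (MvPolynomial.X pq.1 - MvPolynomial.X pq.2))

/-- The inverse of the isomorphism `φ : V̂^{⊗ n} ⊗_{ℂ S_n} C̃ → ⨁_ν C_ν`. On the summand `C_ν` it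
sends `z` to `(v_{a_1} ⊗ ⋯ ⊗ v_{a_n}) ⊗ ε_ν z`, where `a_1 ≤ ⋯ ≤ a_n` and exactly `ν_i` of the
integers `a_1, …, a_n` are equal to `i`. -/
def phiInv (n : ℕ) : SumPCoinv n →ₗ[ℂ] SchurSpace n :=
  DirectSum.toModule ℂ (Comp n) (SchurSpace n) fun ν =>
    (relations n).mkQ ∘ₗ TensorProduct.mk ℂ (TensorPow n) (Coinv n)
        (PiTensorProduct.tprod ℂ fun p => v (colour ν p)) ∘ₗ
      LinearMap.mulLeft ℂ (eps ν) ∘ₗ (PCoinv.val ν).toLinearMap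

/-- The action of `gl_∞` on `⨁_ν C_ν`, transported from `V̂^{⊗ n} ⊗_{ℂ S_n} C̃` along `φ`. -/
def coinvRep (hφ : Function.Bijective (phiInv n)) :
    glInf →ₗ⁅ℂ⁆ Module.End ℂ (SumPCoinv n) :=
  ((LinearEquiv.ofBijective (phiInv n) hφ).symm.lieConj : _ →ₗ⁅ℂ⁆ _).comp (schurRep n)

/-! ### The explicit adjunctions and the trace maps in the key situation -/

section Adjunctions

variable (ν ν' : Comp n)

/-- The functor `C_{ν,ν'} ⊗_{C_{ν'}} ?` from `C_{ν'}`-modules to `C_ν`-modules. -/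
abbrev toLeft : FGModuleCat.{0} (PCoinv ν') ⥤ FGModuleCat.{0} (PCoinv ν) :=
  tensorFunctor (PCoinv ν') (PCoinv ν) (JCoinv ν ν')

/-- The functor `C_{ν',ν} ⊗_{C_ν} ?` from `C_ν`-modules to `C_{ν'}`-modules. -/
abbrev toRight : FGModuleCat.{0} (PCoinv ν) ⥤ FGModuleCat.{0} (PCoinv ν') :=
  tensorFunctor (PCoinv ν) (PCoinv ν') (JCoinv ν ν')

variable {ν ν'} {i : ℤ}

/-- The adjunction `(C_{ν,ν'} ⊗ ?, C_{ν',ν} ⊗ ?)` whose unit `ι'` and counit `ε` are, with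
`a = ν'_i`, given by `ι'(m) = (-1)^a ∑_{r=0}^a (-1)^r e_r(ν';i) ⊗ x_k^{a-r} ⊗ m` and
`ε(x_k^r ⊗ x_k^s ⊗ m) = (-1)^a h_{r+s-a}(ν;i) m`. -/
structure IsFirstAdjunction (hk : KeySituation ν ν' i) (adj : toLeft ν ν' ⊣ toRight ν ν') :
    Prop where
  unit_apply : ∀ (M : FGModuleCat.{0} (PCoinv ν')) (m : M),
    (adj.unit.app M).hom.hom m =
      ((-1 : PCoinv ν') ^ (ν'.1 i) • ∑ r ∈ Finset.range (ν'.1 i + 1), (-1 : PCoinv ν') ^ r •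
        (algebraMap (PCoinv ν') (JCoinv ν ν') (e ν' r i) ⊗ₜ[PCoinv ν]
          ((hk.x ^ (ν'.1 i - r)) ⊗ₜ[PCoinv ν'] m)) :
        JCoinv ν ν' ⊗[PCoinv ν] (JCoinv ν ν' ⊗[PCoinv ν'] M))
  counit_apply : ∀ (M : FGModuleCat.{0} (PCoinv ν)) (r s : ℕ) (m : M),
    (adj.counit.app M).hom.hom ((hk.x ^ r) ⊗ₜ[PCoinv ν'] ((hk.x ^ s) ⊗ₜ[PCoinv ν] m) :
        JCoinv ν ν' ⊗[PCoinv ν'] (JCoinv ν ν' ⊗[PCoinv ν] M)) =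
      ((-1 : PCoinv ν) ^ (ν'.1 i) * h ν ((r : ℤ) + s - ν'.1 i) i) • m

/-- The adjunction `(C_{ν',ν} ⊗ ?, C_{ν,ν'} ⊗ ?)` whose unit `ι` and counit `ε'` are, with
`b = ν_{i+1}`, given by `ι(m) = ∑_{r=0}^b (-1)^r e_r(ν;i+1) ⊗ x_k^{b-r} ⊗ m` and
`ε'(x_k^r ⊗ x_k^s ⊗ m) = h_{r+s-b}(ν';i+1) m`. -/
structure IsSecondAdjunction (hk : KeySituation ν ν' i) (adj : toRight ν ν' ⊣ toLeft ν ν') :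
    Prop where
  unit_apply : ∀ (M : FGModuleCat.{0} (PCoinv ν)) (m : M),
    (adj.unit.app M).hom.hom m =
      (∑ r ∈ Finset.range (ν.1 (i + 1) + 1), (-1 : PCoinv ν) ^ r •
        (algebraMap (PCoinv ν) (JCoinv ν ν') (e ν r (i + 1)) ⊗ₜ[PCoinv ν']
          ((hk.x ^ (ν.1 (i + 1) - r)) ⊗ₜ[PCoinv ν] m)) :
        JCoinv ν ν' ⊗[PCoinv ν'] (JCoinv ν ν' ⊗[PCoinv ν] M))
  counit_apply : ∀ (M : FGModuleCat.{0} (PCoinv ν')) (r s : ℕ) (m : M),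
    (adj.counit.app M).hom.hom ((hk.x ^ r) ⊗ₜ[PCoinv ν] ((hk.x ^ s) ⊗ₜ[PCoinv ν'] m) :
        JCoinv ν ν' ⊗[PCoinv ν] (JCoinv ν ν' ⊗[PCoinv ν'] M)) =
      h ν' ((r : ℤ) + s - ν.1 (i + 1)) (i + 1) • m

/-- The trace map `E_i : C_{ν'} → C_ν`, with the centres of the module categories identified with
the algebras: `E_i(z')` is `ε ∘ (1 z' 1) ∘ ι`. -/
def traceE (adj₁ : toLeft ν ν' ⊣ toRight ν ν') (adj₂ : toRight ν ν' ⊣ toLeft ν ν')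
    (z' : PCoinv ν') : PCoinv ν :=
  (centreEquiv (PCoinv ν)).symm (trace adj₂ adj₁ (centreEquiv (PCoinv ν') z'))

/-- The trace map `F_i : C_ν → C_{ν'}`, with the centres of the module categories identified with
the algebras: `F_i(z)` is `ε' ∘ (1 z 1) ∘ ι'`. -/
def traceF (adj₁ : toLeft ν ν' ⊣ toRight ν ν') (adj₂ : toRight ν ν' ⊣ toLeft ν ν')
    (z : PCoinv ν) : PCoinv ν' :=
  (centreEquiv (PCoinv ν')).symm (trace adj₁ adj₂ (centreEquiv (PCoinv ν) z))

end Adjunctions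

end TraceMaps

end

/-! Put D = C_{ν,ν'} and let H be the intersection of S_ν and S_{ν'}. The position k lies in block i
of ν and in block i+1 of ν', and every other position has the same colour in both compositions.
Hence H is the stabilizer of k in S_ν and also in S_{ν'}, and the two inclusions of rings into D are
instances of one situation, `SplitModel`, for a composition μ and a position k with b further
positions in its block.

Over C_μ the algebra D is spanned by the powers of x_k (`card_smul_eq_sum`), and the generating
polynomial of the e_s of the block splits as (1 + x_k t) ∑ E_r t^r with a second factor of degree at
most b. Let ∂_μ be antisymmetrization over S_μ divided by the product of the root differences x_p -
x_q in the blocks. The form θ(d) = |H|⁻¹ ∂_μ(Δ d), where Δ is the product of the differences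
avoiding k, kills x_k^j for j < b by degree (`divDiff_vandAway_mul_pow`) and takes the value ±1 at
x_k^b. The factorization then forces θ(x_k^j) = ±h_{j-b} (`form_pow_add`) and makes ±∑ (-1)^r E_r ⊗
x_k^{b-r} a Casimir element dual to θ (`mul_casimirSum`, `LinearFactor.frobeniusSystem`). A
Frobenius system gives an adjunction whose triangle identities are the two reproducing formulas of θ
(`FrobeniusSystem.adjunction`); these are the adjunctions of (1), and the unit alone determines
them.

A trace map combines the Casimir element over C_ρ with the form over C_μ, where {ρ, μ} = {ν, ν'}.
Multiplied out, the Casimir element is ±∏ (x_k - x_q), which Δ completes to the Vandermonde product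
of ρ, that is, to a multiple of ε_ρ. So the trace is z ↦ (b+1) ∂_μ(ε_ρ z), with b taken for ρ
(`form_mul_sum`).

On tensor space the Chevalley generator changes the colour of one of the b+1 positions in the block
of k. All b+1 results agree, because ε_ρ z is fixed by the twisted action of S_ρ
(`schurRep_pureVec`). Rewriting the outcome through φ replaces a vector c by ∂_μ c
(`pureVec_colour`), which gives the same formula. Bijectivity of φ⁻¹ rests on the same operators: z
↦ ε_ν z and ∂_ν identify C_ν with the S_ν-invariants of the twisted module. -/

noncomputable section

namespace TraceMaps

variable {n : ℕ}

/-! ### Differences of variables -/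

/-- The substitution `x_p ↦ x_q`. -/
def identify (p q : Fin n) : MvPolynomial (Fin n) ℂ →ₐ[ℂ] MvPolynomial (Fin n) ℂ :=
  MvPolynomial.aeval fun t => MvPolynomial.X (if t = p then q else t)

lemma sub_dvd_sub_identify (p q : Fin n) (f : MvPolynomial (Fin n) ℂ) :
    (MvPolynomial.X p - MvPolynomial.X q : MvPolynomial (Fin n) ℂ) ∣ f - identify p q f := by
  induction f using MvPolynomial.induction_on with
  | C a => simp [identify]
  | add f g hf hg =>
    rw [map_add, add_sub_add_comm]
    exact dvd_add hf hg
  | mul_X f t hf =>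
    have h : f * MvPolynomial.X t - identify p q (f * MvPolynomial.X t) =
        (f - identify p q f) * MvPolynomial.X t +
          identify p q f * (MvPolynomial.X t - identify p q (MvPolynomial.X t)) := by
      rw [map_mul]; ring
    rw [h]
    refine dvd_add (hf.mul_right _) (Dvd.dvd.mul_left ?_ _)
    rw [identify, MvPolynomial.aeval_X]
    split_ifs with h
    · rw [h]
    · simp

lemma sub_dvd_iff (p q : Fin n) (f : MvPolynomial (Fin n) ℂ) :
    (MvPolynomial.X p - MvPolynomial.X q : MvPolynomial (Fin n) ℂ) ∣ f ↔ identify p q f = 0 := by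
  constructor
  · rintro ⟨g, rfl⟩
    rw [map_mul, map_sub]
    have : identify p q (MvPolynomial.X p) = identify p q (MvPolynomial.X q) := by
      simp only [identify, MvPolynomial.aeval_X, if_true]
      split_ifs <;> rfl
    rw [this, sub_self, zero_mul]
  · intro h
    simpa [h] using sub_dvd_sub_identify p q f

lemma X_sub_X_ne_zero {p q : Fin n} (h : p ≠ q) :
    (MvPolynomial.X p - MvPolynomial.X q : MvPolynomial (Fin n) ℂ) ≠ 0 := by
  rw [sub_ne_zero]
  exact fun h' => h (MvPolynomial.X_injective h')

/-- Divisibility means vanishing under the ring homomorphism `identify p q` into a domain. -/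
lemma prime_X_sub_X {p q : Fin n} (h : p ≠ q) :
    Prime (MvPolynomial.X p - MvPolynomial.X q : MvPolynomial (Fin n) ℂ) := by
  refine ⟨X_sub_X_ne_zero h, ?_, fun f g => ?_⟩
  · rw [isUnit_iff_dvd_one, sub_dvd_iff, map_one]
    exact one_ne_zero
  · simp only [sub_dvd_iff, map_mul, mul_eq_zero, imp_self]

/-- The inequalities exclude the pair x_p - x_q, x_q - x_p of associates. -/
lemma isRelPrime_X_sub_X {p q p' q' : Fin n} (h : p < q) (h' : p' < q')
    (hne : (p, q) ≠ (p', q')) :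
    IsRelPrime (MvPolynomial.X p - MvPolynomial.X q : MvPolynomial (Fin n) ℂ)
      (MvPolynomial.X p' - MvPolynomial.X q') := by
  rw [(prime_X_sub_X h.ne).irreducible.isRelPrime_iff_not_dvd, sub_dvd_iff, map_sub, identify,
    MvPolynomial.aeval_X, MvPolynomial.aeval_X, sub_eq_zero]
  intro heq
  have := MvPolynomial.X_injective heq
  have hne' : p = p' → q ≠ q' := fun h1 h2 => hne (by rw [h1, h2])
  split_ifs at this with h1 h2 h2
  · exact absurd h1 (h'.trans_eq h2).ne
  · exact hne' h1.symm this
  · subst h2; subst this; exact absurd h (not_lt.mpr h'.le)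
  · exact h'.ne this

/-- A polynomial that changes sign under the transposition of `x_p` and `x_q` is divisible by
`x_p - x_q`. -/
lemma sub_dvd_of_rename_swap {p q : Fin n} {f : MvPolynomial (Fin n) ℂ}
    (hf : MvPolynomial.rename (Equiv.swap p q) f = -f) :
    (MvPolynomial.X p - MvPolynomial.X q : MvPolynomial (Fin n) ℂ) ∣ f := by
  rw [sub_dvd_iff]
  -- Both variables go to x_q, so the swap is invisible after `identify`; the image of f therefore
  -- equals its own negative.
  have h : (identify p q).comp (MvPolynomial.rename (Equiv.swap p q)) = identify p q := by
    refine MvPolynomial.algHom_ext fun t => ?_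
    rw [AlgHom.comp_apply, MvPolynomial.rename_X, identify, MvPolynomial.aeval_X,
      MvPolynomial.aeval_X]
    congr 1
    rcases eq_or_ne t p with rfl | hp
    · simp
    · rcases eq_or_ne t q with rfl | hq
      · simp
      · rw [Equiv.swap_apply_of_ne_of_ne hp hq]
  have h2 := DFunLike.congr_fun h f
  rw [AlgHom.comp_apply, hf, map_neg] at h2
  have h3 : (2 : ℂ) • identify p q f = 0 := by
    rw [two_smul]; nth_rewrite 1 [← h2]; exact neg_add_cancel _
  exact (smul_eq_zero.mp h3).resolve_left two_ne_zero

/-! ### Antisymmetrization over a parabolic subgroup -/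

/-- The elements of the parabolic subgroup `S_ν`. -/
def parFin (ν : Comp n) : Finset (Equiv.Perm (Fin n)) := {w | ∀ p, colour ν (w p) = colour ν p}

lemma mem_parFin {ν : Comp n} {w : Equiv.Perm (Fin n)} :
    w ∈ parFin ν ↔ ∀ p, colour ν (w p) = colour ν p := by
  simp [parFin]

lemma mem_parFin_iff {ν : Comp n} {w : Equiv.Perm (Fin n)} :
    w ∈ parFin ν ↔ w ∈ parabolic ν := mem_parFin

lemma card_parabolic (ν : Comp n) : Nat.card (parabolic ν) = (parFin ν).card :=
  Nat.subtype_card _ fun _ => mem_parFin_iff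

lemma card_parFin_ne_zero (ν : Comp n) : ((parFin ν).card : ℂ) ≠ 0 :=
  Nat.cast_ne_zero.mpr (Finset.card_ne_zero.mpr ⟨1, mem_parFin.mpr fun _ => rfl⟩)

/-- The sign of a permutation, as a complex number. -/
def sgn (w : Equiv.Perm (Fin n)) : ℂ := ((Equiv.Perm.sign w : ℤ) : ℂ)

lemma sgn_mul (u w : Equiv.Perm (Fin n)) : sgn (u * w) = sgn u * sgn w := by
  simp [sgn]

lemma sgn_mul_self (w : Equiv.Perm (Fin n)) : sgn w * sgn w = 1 := by
  rcases Int.units_eq_one_or (Equiv.Perm.sign w) with h | h <;> simp [sgn, h]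

lemma sgn_swap {p q : Fin n} (h : p ≠ q) : sgn (Equiv.swap p q) = -1 := by
  simp [sgn, Equiv.Perm.sign_swap h]

lemma colour_mono (ν : Comp n) : Monotone (colour ν) := by
  intro p q hpq
  have hp := (colour_eq_iff ν p _).mp rfl
  have hq := (colour_eq_iff ν q _).mp rfl
  by_contra hlt
  have h1 := psum_mono ν (show colour ν q ≤ colour ν p - 1 by omega)
  have h2 : (p : ℕ) ≤ q := hpq
  omega

/-- The product of all `x_p - x_q` with `p < q` in the same block of `ν`. -/
def vand (ν : Comp n) : MvPolynomial (Fin n) ℂ :=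
  ∏ pq : Fin n × Fin n with pq.1 < pq.2 ∧ colour ν pq.1 = colour ν pq.2,
    (MvPolynomial.X pq.1 - MvPolynomial.X pq.2)

lemma vand_ne_zero (ν : Comp n) : vand ν ≠ 0 := by
  refine Finset.prod_ne_zero_iff.mpr fun pq hpq => X_sub_X_ne_zero ?_
  exact (Finset.mem_filter.mp hpq).2.1.ne

/-- The product is the Vandermonde determinant in the -x_p, and w permutes its rows. -/
lemma rename_prod_X_sub_X (w : Equiv.Perm (Fin n)) :
    MvPolynomial.rename w (∏ pq : Fin n × Fin n with pq.1 < pq.2,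
        (MvPolynomial.X pq.1 - MvPolynomial.X pq.2 : MvPolynomial (Fin n) ℂ)) =
      sgn w • ∏ pq : Fin n × Fin n with pq.1 < pq.2, (MvPolynomial.X pq.1 - MvPolynomial.X pq.2) := by
  have key : ∀ u : Fin n → Fin n, (∏ pq : Fin n × Fin n with pq.1 < pq.2,
      (MvPolynomial.X (u pq.1) - MvPolynomial.X (u pq.2) : MvPolynomial (Fin n) ℂ)) =
      (Matrix.vandermonde fun p => -MvPolynomial.X (u p)).det := by
    intro u
    rw [Matrix.det_vandermonde, Finset.prod_filter, Fintype.prod_prod_type]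
    refine Finset.prod_congr rfl fun p _ => ?_
    rw [← Finset.prod_filter, Finset.filter_lt_eq_Ioi]
    exact Finset.prod_congr rfl fun q _ => by ring
  rw [map_prod]
  simp only [map_sub, MvPolynomial.rename_X]
  rw [key w, key fun p => p]
  refine (Matrix.det_permute w
    (Matrix.vandermonde fun p => -(MvPolynomial.X p : MvPolynomial (Fin n) ℂ))).trans ?_
  rw [sgn, MvPolynomial.smul_eq_C_mul]
  simp

/-- Colours increase weakly with position, so the full product over p < q is `vand ν` times the
differences between distinct blocks. S_ν permutes the latter without sign changes, and cancelling
them leaves the sign to `vand ν`. -/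
lemma rename_vand {ν : Comp n} {w : Equiv.Perm (Fin n)} (hw : w ∈ parFin ν) :
    MvPolynomial.rename w (vand ν) = sgn w • vand ν := by
  set rest : MvPolynomial (Fin n) ℂ := ∏ pq : Fin n × Fin n with colour ν pq.1 < colour ν pq.2,
    (MvPolynomial.X pq.1 - MvPolynomial.X pq.2) with hrest
  have h1 : vand ν * rest =
      ∏ pq : Fin n × Fin n with pq.1 < pq.2, (MvPolynomial.X pq.1 - MvPolynomial.X pq.2) := by
    rw [vand, hrest, ← Finset.prod_union]
    · refine Finset.prod_congr ?_ fun _ _ => rfl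
      ext ⟨p, q⟩
      simp only [Finset.mem_union, Finset.mem_filter, Finset.mem_univ, true_and]
      constructor
      · rintro (h | h)
        · exact h.1
        · exact (colour_mono ν).reflect_lt h
      · intro h
        rcases (colour_mono ν h.le).eq_or_lt with h' | h'
        · exact Or.inl ⟨h, h'⟩
        · exact Or.inr h'
    · refine Finset.disjoint_filter.mpr fun pq _ h h' => h'.ne h.2
  have h2 : MvPolynomial.rename w rest = rest := by
    rw [hrest, map_prod]
    refine Finset.prod_equiv (w.prodCongr w) (fun pq => ?_) fun pq _ => ?_
    · simp [mem_parFin.mp hw]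
    · simp
  have h3 : rest ≠ 0 := by
    refine Finset.prod_ne_zero_iff.mpr fun pq hpq => X_sub_X_ne_zero ?_
    exact ((colour_mono ν).reflect_lt (Finset.mem_filter.mp hpq).2).ne
  refine mul_right_cancel₀ h3 ?_
  nth_rewrite 1 [← h2]
  rw [← map_mul, h1, rename_prod_X_sub_X, ← h1, smul_mul_assoc]

lemma swap_mem_parFin {μ : Comp n} {p q : Fin n} (h : colour μ p = colour μ q) :
    Equiv.swap p q ∈ parFin μ := by
  rw [mem_parFin]
  intro t
  rcases eq_or_ne t p with rfl | hp
  · rw [Equiv.swap_apply_left, h]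
  · rcases eq_or_ne t q with rfl | hq
    · rw [Equiv.swap_apply_right, h]
    · rw [Equiv.swap_apply_of_ne_of_ne hp hq]

lemma vand_dvd {ν : Comp n} {f : MvPolynomial (Fin n) ℂ}
    (hf : ∀ w ∈ parFin ν, MvPolynomial.rename w f = sgn w • f) : vand ν ∣ f := by
  refine Finset.prod_dvd_of_isRelPrime ?_ ?_
  · rintro ⟨p, q⟩ h ⟨p', q'⟩ h' hne
    simp only [Finset.coe_filter, Finset.mem_univ, true_and, Set.mem_ofPred_eq] at h h'
    exact isRelPrime_X_sub_X h.1 h'.1 hne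
  · rintro ⟨p, q⟩ h
    simp only [Finset.mem_filter, Finset.mem_univ, true_and] at h
    refine sub_dvd_of_rename_swap ?_
    rw [hf, sgn_swap h.1.ne, neg_one_smul]
    exact swap_mem_parFin h.2

/-- The antisymmetrization of a polynomial over `S_ν`. -/
def antisym (ν : Comp n) : MvPolynomial (Fin n) ℂ →ₗ[ℂ] MvPolynomial (Fin n) ℂ :=
  ∑ w ∈ parFin ν, sgn w • (MvPolynomial.rename w).toLinearMap

lemma antisym_apply (ν : Comp n) (f : MvPolynomial (Fin n) ℂ) :
    antisym ν f = ∑ w ∈ parFin ν, sgn w • MvPolynomial.rename w f := by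
  simp [antisym]

lemma rename_mul (u w : Equiv.Perm (Fin n)) (f : MvPolynomial (Fin n) ℂ) :
    MvPolynomial.rename (u * w : Equiv.Perm (Fin n)) f =
      MvPolynomial.rename u (MvPolynomial.rename w f) := by
  rw [MvPolynomial.rename_rename]; rfl

lemma sum_parFin_mul_left {α : Type*} [AddCommMonoid α] {ν : Comp n} {u : Equiv.Perm (Fin n)}
    (hu : u ∈ parFin ν) (F : Equiv.Perm (Fin n) → α) :
    ∑ w ∈ parFin ν, F (u * w) = ∑ w ∈ parFin ν, F w := by
  refine Finset.sum_equiv (Equiv.mulLeft u) (fun w => ?_) fun _ _ => rfl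
  rw [mem_parFin_iff, mem_parFin_iff, Equiv.coe_mulLeft,
    (parabolic ν).mul_mem_cancel_left (mem_parFin_iff.mp hu)]

lemma rename_antisym {ν : Comp n} {u : Equiv.Perm (Fin n)} (hu : u ∈ parFin ν)
    (f : MvPolynomial (Fin n) ℂ) :
    MvPolynomial.rename u (antisym ν f) = sgn u • antisym ν f := by
  rw [antisym_apply, map_sum, Finset.smul_sum,
    ← sum_parFin_mul_left hu fun w => sgn u • sgn w • MvPolynomial.rename w f]
  refine Finset.sum_congr rfl fun w _ => ?_
  rw [map_smul, rename_mul, sgn_mul, smul_smul, ← mul_assoc, sgn_mul_self, one_mul]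

lemma vand_dvd_antisym (ν : Comp n) (f : MvPolynomial (Fin n) ℂ) : vand ν ∣ antisym ν f :=
  vand_dvd fun _ hw => rename_antisym hw f

/-- The divided difference operator attached to `S_ν`: the antisymmetrization over `S_ν` divided by
the product of all `x_p - x_q` with `p < q` in the same block. -/
def divDiff (ν : Comp n) : MvPolynomial (Fin n) ℂ →ₗ[ℂ] MvPolynomial (Fin n) ℂ where
  toFun f := (vand_dvd_antisym ν f).choose
  map_add' f g := by
    refine mul_left_cancel₀ (vand_ne_zero ν) ?_
    rw [mul_add, ← (vand_dvd_antisym ν _).choose_spec, ← (vand_dvd_antisym ν _).choose_spec,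
      ← (vand_dvd_antisym ν _).choose_spec, map_add]
  map_smul' c f := by
    refine mul_left_cancel₀ (vand_ne_zero ν) ?_
    rw [mul_smul_comm, ← (vand_dvd_antisym ν _).choose_spec,
      ← (vand_dvd_antisym ν _).choose_spec, map_smul, RingHom.id_apply]

lemma vand_mul_divDiff (ν : Comp n) (f : MvPolynomial (Fin n) ℂ) :
    vand ν * divDiff ν f = antisym ν f :=
  (vand_dvd_antisym ν f).choose_spec.symm

lemma rename_divDiff {ν : Comp n} {w : Equiv.Perm (Fin n)} (hw : w ∈ parFin ν)
    (f : MvPolynomial (Fin n) ℂ) : MvPolynomial.rename w (divDiff ν f) = divDiff ν f := by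
  have h := rename_antisym hw f
  rw [← vand_mul_divDiff, map_mul, rename_vand hw, smul_mul_assoc] at h
  exact mul_left_cancel₀ (vand_ne_zero ν)
    (smul_right_injective _ (left_ne_zero_of_mul_eq_one (sgn_mul_self w)) h)

lemma divDiff_mul {ν : Comp n} {g : MvPolynomial (Fin n) ℂ}
    (hg : ∀ w ∈ parFin ν, MvPolynomial.rename w g = g) (f : MvPolynomial (Fin n) ℂ) :
    divDiff ν (g * f) = g * divDiff ν f := by
  refine mul_left_cancel₀ (vand_ne_zero ν) ?_
  rw [vand_mul_divDiff, mul_left_comm, vand_mul_divDiff, antisym_apply, antisym_apply,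
    Finset.mul_sum]
  refine Finset.sum_congr rfl fun w hw => ?_
  rw [map_mul, hg w hw, mul_smul_comm]

lemma divDiff_vand (ν : Comp n) : divDiff ν (vand ν) = MvPolynomial.C ((parFin ν).card : ℂ) := by
  refine mul_left_cancel₀ (vand_ne_zero ν) ?_
  rw [vand_mul_divDiff, antisym_apply, Finset.sum_congr rfl fun w hw => by
    rw [rename_vand hw, smul_smul, sgn_mul_self, one_smul]]
  simp [mul_comm]

/-- Symmetric generators can be pulled out of `divDiff`, arbitrary coefficients cannot; so the
induction runs over all multiples g * f and specializes to g = 1 at the end. -/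
lemma divDiff_mem_symIdeal (ν : Comp n) {f : MvPolynomial (Fin n) ℂ} (hf : f ∈ symIdeal n) :
    divDiff ν f ∈ symIdeal n := by
  refine Submodule.span_induction (p := fun f _ => ∀ g, divDiff ν (g * f) ∈ symIdeal n)
    ?_ ?_ ?_ ?_ hf 1 |> (by simpa using ·)
  · intro s hs g
    rw [mul_comm, divDiff_mul fun w _ => hs.1 w]
    exact Ideal.mul_mem_right _ _ (Ideal.subset_span hs)
  · simp
  · intro f₁ f₂ _ _ h₁ h₂ g
    rw [mul_add, map_add]
    exact add_mem (h₁ g) (h₂ g)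
  · intro a f _ h g
    rw [smul_eq_mul, ← mul_assoc]
    exact h _

/-! ### Divided differences on the coinvariant algebra -/

lemma toCoinv_surjective (n : ℕ) : Function.Surjective (toCoinv n) :=
  Ideal.Quotient.mk_surjective

lemma toCoinv_eq_iff {f g : MvPolynomial (Fin n) ℂ} :
    toCoinv n f = toCoinv n g ↔ f - g ∈ symIdeal n :=
  Ideal.Quotient.eq

lemma perm_mul (u w : Equiv.Perm (Fin n)) (c : Coinv n) : perm (u * w) c = perm u (perm w c) := by
  obtain ⟨f, rfl⟩ := toCoinv_surjective n c
  rw [perm_toCoinv, perm_toCoinv, perm_toCoinv, rename_mul]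

/-- Invariants in the coinvariant algebra lift to invariant polynomials. -/
lemma exists_invariant_lift {G : Subgroup (Equiv.Perm (Fin n))} {c : Coinv n} (hc : c ∈ inv G) :
    ∃ f : MvPolynomial (Fin n) ℂ,
      toCoinv n f = c ∧ ∀ w ∈ G, MvPolynomial.rename w f = f := by
  classical
  obtain ⟨f, rfl⟩ := toCoinv_surjective n c
  refine ⟨(Fintype.card G : ℂ)⁻¹ • ∑ w : G, MvPolynomial.rename (w : Equiv.Perm (Fin n)) f,
    ?_, fun u hu => ?_⟩
  · rw [map_smul, map_sum, Finset.sum_congr rfl fun w _ => by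
      rw [← perm_toCoinv, hc w.1 w.2], Finset.sum_const, Finset.card_univ, ← Nat.cast_smul_eq_nsmul ℂ,
      smul_smul, inv_mul_cancel₀ (Nat.cast_ne_zero.mpr Fintype.card_ne_zero), one_smul]
  · rw [map_smul, map_sum]
    congr 1
    refine Fintype.sum_equiv (Equiv.mulLeft (⟨u, hu⟩ : G)) _ _ fun w => ?_
    rw [← rename_mul]
    rfl

lemma PCoinv.perm_val {ν : Comp n} (z : PCoinv ν) {w : Equiv.Perm (Fin n)} (hw : w ∈ parFin ν) :
    perm w (PCoinv.val ν z) = PCoinv.val ν z :=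
  z.2 w (mem_parFin_iff.mp hw)

lemma PCoinv.val_injective (ν : Comp n) : Function.Injective (PCoinv.val ν) :=
  Subtype.val_injective

/-- The divided difference operator `C → C_ν`. -/
def coinvDivDiff (ν : Comp n) : Coinv n →ₗ[ℂ] PCoinv ν where
  toFun c := ⟨toCoinv n (divDiff ν (Function.surjInv (toCoinv_surjective n) c)), fun w hw => by
    rw [perm_toCoinv, rename_divDiff (mem_parFin_iff.mpr hw)]⟩
  map_add' c d := by
    refine PCoinv.val_injective ν ?_
    change toCoinv n _ = toCoinv n _ + toCoinv n _
    rw [← map_add, ← map_add, toCoinv_eq_iff, ← map_sub]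
    refine divDiff_mem_symIdeal ν ?_
    rw [← toCoinv_eq_iff, map_add]
    simp only [Function.surjInv_eq]
  map_smul' a c := by
    refine PCoinv.val_injective ν ?_
    change toCoinv n _ = a • toCoinv n _
    rw [← map_smul, ← map_smul, toCoinv_eq_iff, ← map_sub]
    refine divDiff_mem_symIdeal ν ?_
    rw [← toCoinv_eq_iff, map_smul]
    simp only [Function.surjInv_eq]

lemma coinvDivDiff_toCoinv (ν : Comp n) (f : MvPolynomial (Fin n) ℂ) :
    PCoinv.val ν (coinvDivDiff ν (toCoinv n f)) = toCoinv n (divDiff ν f) := by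
  change toCoinv n _ = toCoinv n _
  rw [toCoinv_eq_iff, ← map_sub]
  refine divDiff_mem_symIdeal ν ?_
  rw [← toCoinv_eq_iff]
  exact Function.surjInv_eq _ _

/-- An invariant class has an invariant polynomial as representative, by averaging, so the linearity
of `divDiff` over invariant polynomials descends. -/
lemma coinvDivDiff_val_mul (ν : Comp n) (z : PCoinv ν) (c : Coinv n) :
    coinvDivDiff ν (PCoinv.val ν z * c) = z * coinvDivDiff ν c := by
  obtain ⟨g, hg, hg'⟩ := exists_invariant_lift z.2
  obtain ⟨f, rfl⟩ := toCoinv_surjective n c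
  refine PCoinv.val_injective ν ?_
  change toCoinv n g = PCoinv.val ν z at hg
  rw [map_mul (PCoinv.val ν), ← hg, ← map_mul, coinvDivDiff_toCoinv, coinvDivDiff_toCoinv,
    ← map_mul, divDiff_mul fun w hw => hg' w (mem_parFin_iff.mp hw)]

lemma eps_eq (ν : Comp n) : eps ν = ((parFin ν).card : ℂ)⁻¹ • toCoinv n (vand ν) := by
  rw [eps, ← MvPolynomial.smul_eq_C_mul, map_smul, card_parabolic]
  rfl

lemma coinvDivDiff_vand (ν : Comp n) :
    coinvDivDiff ν (toCoinv n (vand ν)) = algebraMap ℂ (PCoinv ν) (parFin ν).card := by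
  refine PCoinv.val_injective ν ?_
  rw [coinvDivDiff_toCoinv, divDiff_vand, AlgHom.commutes]
  exact (toCoinv n).commutes _

lemma coinvDivDiff_eps_mul (ν : Comp n) (z : PCoinv ν) :
    coinvDivDiff ν (eps ν * PCoinv.val ν z) = z := by
  rw [mul_comm, coinvDivDiff_val_mul, eps_eq, map_smul, coinvDivDiff_vand, Algebra.smul_def,
    ← map_mul, inv_mul_cancel₀ (card_parFin_ne_zero ν), map_one, mul_one]

lemma twist_apply (w : Equiv.Perm (Fin n)) (c : Coinv n) : twist w c = sgn w • perm w c := rfl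

lemma twist_mul (u w : Equiv.Perm (Fin n)) (c : Coinv n) :
    twist (u * w) c = twist u (twist w c) := by
  rw [twist_apply, twist_apply, twist_apply, map_smul, smul_smul, perm_mul, sgn_mul]

lemma twist_eps_mul {ν : Comp n} (z : PCoinv ν) {w : Equiv.Perm (Fin n)} (hw : w ∈ parFin ν) :
    twist w (eps ν * PCoinv.val ν z) = eps ν * PCoinv.val ν z := by
  rw [twist_apply, map_mul, z.perm_val hw, eps_eq, map_smul, perm_toCoinv, rename_vand hw,
    map_smul, smul_comm, smul_mul_assoc, smul_smul, sgn_mul_self, one_smul]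

/-- Together with `coinvDivDiff_eps_mul`, this shows that multiplication by ε_ν embeds C_ν onto the
S_ν-invariants of the twisted module, with the averaging projection factoring through ∂_ν. -/
lemma eps_mul_coinvDivDiff (ν : Comp n) (c : Coinv n) :
    eps ν * PCoinv.val ν (coinvDivDiff ν c) =
      ((parFin ν).card : ℂ)⁻¹ • ∑ w ∈ parFin ν, twist w c := by
  obtain ⟨f, rfl⟩ := toCoinv_surjective n c
  rw [coinvDivDiff_toCoinv, eps_eq, smul_mul_assoc, ← map_mul, vand_mul_divDiff, antisym_apply,
    map_sum]
  simp only [map_smul, twist_apply, perm_toCoinv]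

/-! ### The isomorphism between tensor space and the sum of the partial coinvariant algebras -/

/-- The vector `(v_{a_1} ⊗ ⋯ ⊗ v_{a_n}) ⊗ c` of `V̂^{⊗ n} ⊗_{ℂ S_n} C̃`. -/
def pureVec (a : Fin n → ℤ) : Coinv n →ₗ[ℂ] SchurSpace n :=
  (relations n).mkQ ∘ₗ TensorProduct.mk ℂ (TensorPow n) (Coinv n)
    (PiTensorProduct.tprod ℂ fun p => v (a p))

lemma phiInv_lof (ν : Comp n) (z : PCoinv ν) :
    phiInv n (DirectSum.lof ℂ (Comp n) PCoinv ν z) =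
      pureVec (colour ν) (eps ν * PCoinv.val ν z) :=
  DirectSum.toModule_lof ℂ ν z

lemma pureVec_comp (a : Fin n → ℤ) (w : Equiv.Perm (Fin n)) (c : Coinv n) :
    pureVec (a ∘ w) c = pureVec a (twist w c) := by
  refine (Submodule.Quotient.eq (relations n)).mpr (Submodule.subset_span
    ⟨w, PiTensorProduct.tprod ℂ fun p => v (a p), c, ?_⟩)
  rw [rightPerm_tprod]
  rfl

/-- Permutations in S_ν fix the tensor of colours, so the relations allow c to be replaced by its
twisted average, which is ε_ν ∂_ν c. -/
lemma pureVec_colour (ν : Comp n) (c : Coinv n) :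
    pureVec (colour ν) c = phiInv n (DirectSum.lof ℂ (Comp n) PCoinv ν (coinvDivDiff ν c)) := by
  have h : ∀ w ∈ parFin ν, pureVec (colour ν) (twist w c) = pureVec (colour ν) c := by
    intro w hw
    rw [← pureVec_comp, show colour ν ∘ w = colour ν from funext (mem_parFin.mp hw)]
  rw [phiInv_lof, eps_mul_coinvDivDiff, map_smul, map_sum, Finset.sum_congr rfl h,
    Finset.sum_const, ← Nat.cast_smul_eq_nsmul ℂ, smul_smul,
    inv_mul_cancel₀ (card_parFin_ne_zero ν), one_smul]

/-! ### Compositions and weakly increasing sequences of colours. -/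

lemma card_colour_lt (ν : Comp n) (i : ℤ) :
    (Finset.univ.filter fun p => colour ν p ≤ i).card = psum ν i := by
  have h : ∀ p, colour ν p ≤ i ↔ (p : ℕ) < psum ν i := by
    intro p
    have hp := (colour_eq_iff ν p _).mp rfl
    constructor
    · intro h
      exact hp.2.trans_le (psum_mono ν h)
    · intro h
      by_contra hlt
      have := psum_mono ν (show i ≤ colour ν p - 1 by omega)
      omega
  simp only [h]
  rw [Fin.card_filter_val_lt, min_eq_right (psum_le ν i)]

lemma card_colour (ν : Comp n) (i : ℤ) :
    (Finset.univ.filter fun p => colour ν p = i).card = ν.1 i := by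
  have h1 := psum_eq_add ν i
  have h2 : (Finset.univ.filter fun p => colour ν p ≤ i).card =
      (Finset.univ.filter fun p => colour ν p ≤ i - 1).card +
        (Finset.univ.filter fun p => colour ν p = i).card := by
    rw [← Finset.card_union_of_disjoint]
    · congr 1
      ext p
      simp only [Finset.mem_filter, Finset.mem_univ, true_and, Finset.mem_union]
      omega
    · exact Finset.disjoint_filter.mpr fun p _ h h' => by omega
  rw [card_colour_lt, card_colour_lt] at h2
  omega

/-- The composition counting how often each integer occurs in a sequence. -/
def count (a : Fin n → ℤ) : Comp n :=
  ⟨∑ p, Finsupp.single (a p) 1, by simp⟩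

lemma count_apply (a : Fin n → ℤ) (i : ℤ) :
    (count a).1 i = (Finset.univ.filter fun p => a p = i).card := by
  rw [count, Finsupp.finsetSum_apply, Finset.card_filter]
  simp [Finsupp.single_apply]

lemma count_comp (a : Fin n → ℤ) (w : Equiv.Perm (Fin n)) : count (a ∘ w) = count a := by
  refine Subtype.ext ?_
  exact Equiv.sum_comp w fun p => Finsupp.single (a p) 1

lemma count_colour (ν : Comp n) : count (colour ν) = ν :=
  Subtype.ext (Finsupp.ext fun i => by rw [count_apply, card_colour])

/-- A weakly increasing sequence is determined by its values with multiplicities. -/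
lemma colour_count {a : Fin n → ℤ} (ha : Monotone a) : colour (count a) = a := by
  have hs : ∀ i, psum (count a) i = (Finset.univ.filter fun p => a p ≤ i).card := by
    intro i
    rw [psum_eq_sum (count a) i (s := (count a).1.support ∪ Finset.univ.image a)
      Finset.subset_union_left,
      Finset.card_eq_sum_card_fiberwise (f := a)
        (t := ((count a).1.support ∪ Finset.univ.image a).filter (· ≤ i))]
    · refine Finset.sum_congr rfl fun j hj => ?_
      rw [count_apply, Finset.filter_filter]
      congr 1
      ext p
      have := (Finset.mem_filter.mp hj).2
      simp only [Finset.mem_filter, Finset.mem_univ, true_and]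
      omega
    · intro p hp
      simp only [Finset.coe_filter, Finset.mem_univ, true_and, Set.mem_ofPred_eq] at hp ⊢
      exact ⟨by simp, hp⟩
  funext p
  rw [colour_eq_iff, hs, hs]
  constructor
  · have : (Finset.univ.filter fun q => a q ≤ a p - 1) ⊆ Finset.Iio p := by
      intro q hq
      simp only [Finset.mem_filter, Finset.mem_univ, true_and, Finset.mem_Iio] at hq ⊢
      exact ha.reflect_lt (by omega)
    simpa using Finset.card_le_card this
  · have : Finset.Iic p ⊆ (Finset.univ.filter fun q => a q ≤ a p) := by
      intro q hq
      simp only [Finset.mem_filter, Finset.mem_univ, true_and, Finset.mem_Iic] at hq ⊢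
      exact ha hq
    simpa using Finset.card_le_card this

/-! ### Bijectivity of φ⁻¹. -/

lemma phiInv_surjective (n : ℕ) : Function.Surjective (phiInv n) := by
  rw [← LinearMap.range_eq_top, eq_top_iff]
  have hpure : ∀ (a : Fin n → ℤ) (c : Coinv n), pureVec a c ∈ LinearMap.range (phiInv n) := by
    intro a c
    -- Sorting the indices turns any basis tensor into the colour sequence of a composition, at the
    -- cost of twisting c.
    have h : a = colour (count a) ∘ ((Tuple.sort a)⁻¹ : Equiv.Perm (Fin n)) := by
      rw [← count_comp a (Tuple.sort a), colour_count (Tuple.monotone_sort a)]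
      ext p
      simp
    rw [h, pureVec_comp, pureVec_colour]
    exact ⟨_, rfl⟩
  rintro x -
  obtain ⟨y, rfl⟩ := (relations n).mkQ_surjective x
  induction y using TensorProduct.induction_on with
  | zero => rw [map_zero]; exact zero_mem _
  | add y z hy hz => rw [map_add]; exact add_mem hy hz
  | tmul t c =>
    have ht : (⊤ : Submodule ℂ (TensorPow n)) ≤ ((LinearMap.range (phiInv n)).comap
        ((relations n).mkQ ∘ₗ (TensorProduct.mk ℂ (TensorPow n) (Coinv n)).flip c)) := by
      rw [← (Basis.piTensorProduct fun _ : Fin n => natBasis).span_eq, Submodule.span_le]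
      rintro _ ⟨a, rfl⟩
      rw [Basis.piTensorProduct_apply]
      exact hpure a c
    exact ht (Submodule.mem_top (x := t))

/-- The coefficient of `v_{a_1} ⊗ ⋯ ⊗ v_{a_n}` in an element of `V̂^{⊗ n}`. -/
def coeffAt (a : Fin n → ℤ) : TensorPow n →ₗ[ℂ] ℂ :=
  PiTensorProduct.lift ((MultilinearMap.mkPiAlgebra ℂ (Fin n) ℂ).compLinearMap
    fun p => natBasis.coord (a p))

lemma coeffAt_tprod (a : Fin n → ℤ) (u : Fin n → NatMod) :
    coeffAt a (PiTensorProduct.tprod ℂ u) = ∏ p, natBasis.repr (u p) (a p) := by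
  simp [coeffAt]

lemma coeffAt_rightPerm (a : Fin n → ℤ) (w : Equiv.Perm (Fin n)) (t : TensorPow n) :
    coeffAt (a ∘ w) (rightPerm w t) = coeffAt a t := by
  have h : coeffAt (a ∘ w) ∘ₗ rightPerm w = coeffAt a := by
    refine PiTensorProduct.ext (MultilinearMap.ext fun u => ?_)
    simp only [LinearMap.compMultilinearMap_apply, LinearMap.comp_apply, rightPerm_tprod,
      coeffAt_tprod]
    exact Equiv.prod_comp w fun p => natBasis.repr (u p) (a p)
  exact LinearMap.congr_fun h t

lemma coeffAt_pure (a a' : Fin n → ℤ) :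
    coeffAt a (PiTensorProduct.tprod ℂ fun p => v (a' p)) = if a' = a then 1 else 0 := by
  rw [coeffAt_tprod]
  simp only [v, Module.Basis.repr_self, Finsupp.single_apply, funext_iff]
  split_ifs with h
  · exact Finset.prod_eq_one fun p _ => if_pos (h p)
  · obtain ⟨p, hp⟩ := not_forall.mp h
    exact Finset.prod_eq_zero (Finset.mem_univ p) (if_neg hp)

/-- A linear map on `V̂^{⊗ n} ⊗_ℂ C̃` that descends to `V̂^{⊗ n} ⊗_{ℂ S_n} C̃` and gives there, up to
a factor, the component of `φ` in `C_ν`. -/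
def component (ν : Comp n) : TensorPow n ⊗[ℂ] Coinv n →ₗ[ℂ] PCoinv ν :=
  ∑ w : Equiv.Perm (Fin n), TensorProduct.lift
    ((LinearMap.lsmul ℂ (PCoinv ν)).compl₁₂ (coeffAt (colour ν ∘ w)) (coinvDivDiff ν ∘ₗ twist w))

lemma component_tmul (ν : Comp n) (t : TensorPow n) (c : Coinv n) :
    component ν (t ⊗ₜ c) = ∑ w : Equiv.Perm (Fin n),
      coeffAt (colour ν ∘ w) t • coinvDivDiff ν (twist w c) := by
  simp [component, LinearMap.sum_apply]

/-- The sum defining `component` runs over all of S_n, and the relation for w amounts to the right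
translation u ↦ u w of its index. -/
lemma relations_le_ker_component (ν : Comp n) : relations n ≤ LinearMap.ker (component ν) := by
  refine Submodule.span_le.mpr ?_
  rintro _ ⟨w, t, c, rfl⟩
  rw [SetLike.mem_coe, LinearMap.mem_ker, map_sub, sub_eq_zero, component_tmul, component_tmul]
  refine (Equiv.sum_comp (Equiv.mulRight w) _).symm.trans ?_
  refine Finset.sum_congr rfl fun u _ => ?_
  rw [Equiv.coe_mulRight, Equiv.Perm.coe_mul, ← Function.comp_assoc, coeffAt_rightPerm, twist_mul]

/-- Only those w contribute for which the colours of μ are those of ν rearranged by w. Counting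
colours then forces μ = ν and w in S_ν, and each such w contributes z. The factor |S_ν| is
invertible, so these maps detect every component. -/
lemma component_phiInv (ν μ : Comp n) (z : PCoinv μ) :
    (relations n).liftQ (component ν) (relations_le_ker_component ν)
        (phiInv n (DirectSum.lof ℂ (Comp n) PCoinv μ z)) =
      ((parFin ν).card : ℂ) •
        (DirectSum.component ℂ (Comp n) PCoinv ν (DirectSum.lof ℂ (Comp n) PCoinv μ z)) := by
  rw [phiInv_lof]
  change component ν (_ ⊗ₜ _) = _
  rw [component_tmul]
  simp only [coeffAt_pure, ite_smul, one_smul, zero_smul]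
  rw [← Finset.sum_filter]
  rcases eq_or_ne μ ν with rfl | hne
  · rw [DirectSum.component.lof_self, Finset.sum_congr (s₂ := parFin μ) (g := fun _ => z),
      Finset.sum_const, Nat.cast_smul_eq_nsmul]
    · ext w
      rw [Finset.mem_filter, mem_parFin, eq_comm, funext_iff]
      simp
    · intro w hw
      rw [twist_eps_mul z hw, coinvDivDiff_eps_mul]
  · rw [Finset.sum_eq_zero, DirectSum.component.of, dif_neg hne, smul_zero]
    intro w hw
    refine absurd ?_ hne
    rw [← count_colour μ, (Finset.mem_filter.mp hw).2, count_comp, count_colour]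

lemma phiInv_injective (n : ℕ) : Function.Injective (phiInv n) := by
  rw [← LinearMap.ker_eq_bot, eq_bot_iff]
  intro x hx
  rw [LinearMap.mem_ker] at hx
  rw [Submodule.mem_bot]
  refine DirectSum.ext_component ℂ fun ν => ?_
  have h : (relations n).liftQ (component ν) (relations_le_ker_component ν) ∘ₗ phiInv n =
      ((parFin ν).card : ℂ) • DirectSum.component ℂ (Comp n) PCoinv ν :=
    DirectSum.linearMap_ext ℂ fun μ => LinearMap.ext fun z => component_phiInv ν μ z
  have h2 := LinearMap.congr_fun h x
  rw [LinearMap.comp_apply, hx, map_zero, LinearMap.smul_apply, eq_comm, smul_eq_zero] at h2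
  rw [h2.resolve_left (card_parFin_ne_zero ν), map_zero]

lemma phiInv_bijective (n : ℕ) : Function.Bijective (phiInv n) :=
  ⟨phiInv_injective n, phiInv_surjective n⟩

/-! ### Adjunctions from Frobenius extensions -/

/-- A linear form `θ : D → B` on a commutative `B`-algebra `D` together with dual families for it,
written as a Casimir element `∑_r b_r ⊗ b'_r`. -/
structure FrobeniusSystem (B D : Type) [CommRing B] [CommRing D] [Algebra B D] where
  /-- The linear form. -/
  form : D →ₗ[B] B
  /-- The number of terms of the Casimir element. -/
  size : ℕ
  /-- The left factors of the Casimir element. -/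
  left : ℕ → D
  /-- The right factors of the Casimir element. -/
  right : ℕ → D
  casimir : ∀ d : D, ∑ r ∈ Finset.range size, (d * left r) ⊗ₜ[B] right r =
    ∑ r ∈ Finset.range size, left r ⊗ₜ[B] (right r * d)
  form_left : ∑ r ∈ Finset.range size, form (left r) • right r = 1
  form_right : ∑ r ∈ Finset.range size, form (right r) • left r = 1

namespace FrobeniusSystem

variable {A B D : Type} [CommRing A] [CommRing B] [CommRing D] [Algebra A D] [Algebra B D]
  [SMulCommClass A B D] [SMulCommClass B A D] (S : FrobeniusSystem B D)

/-- Apply the form to the left tensor factors of the Casimir identity; `sum_form_right_mul` does so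
with the right ones. -/
lemma sum_form_mul_left (d : D) :
    ∑ r ∈ Finset.range S.size, S.form (d * S.left r) • S.right r = d := by
  have h := congrArg (TensorProduct.lift ((LinearMap.lsmul B D).comp S.form)) (S.casimir d)
  simp only [map_sum, TensorProduct.lift.tmul, LinearMap.comp_apply, LinearMap.lsmul_apply] at h
  rw [h]
  simp only [← smul_mul_assoc]
  rw [← Finset.sum_mul, S.form_left, one_mul]

lemma sum_form_right_mul (d : D) :
    ∑ r ∈ Finset.range S.size, S.form (S.right r * d) • S.left r = d := by
  have h := congrArg (TensorProduct.lift ((LinearMap.lsmul B D).flip.compl₂ S.form)) (S.casimir d)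
  simp only [map_sum, TensorProduct.lift.tmul, LinearMap.compl₂_apply, LinearMap.flip_apply,
    LinearMap.lsmul_apply] at h
  rw [← h]
  simp only [← mul_smul_comm]
  rw [← Finset.mul_sum, S.form_right, mul_one]

/-- The Casimir element in front of a module element. -/
def unitHom (M : Type) [AddCommGroup M] [Module A M] : M →ₗ[A] D ⊗[B] (D ⊗[A] M) where
  toFun m := ∑ r ∈ Finset.range S.size, S.left r ⊗ₜ[B] (S.right r ⊗ₜ[A] m)
  map_add' m m' := by simp only [TensorProduct.tmul_add, Finset.sum_add_distrib]
  map_smul' a m := by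
    -- Linearity over A is the Casimir identity for the image of a in D.
    have h := congrArg (TensorProduct.map (LinearMap.id : D →ₗ[B] D)
      ((TensorProduct.AlgebraTensorModule.mk A B D M).flip m)) (S.casimir (algebraMap A D a))
    rw [map_sum, map_sum] at h
    have h' : ∑ r ∈ Finset.range S.size, (algebraMap A D a * S.left r) ⊗ₜ[B] (S.right r ⊗ₜ[A] m) =
      ∑ r ∈ Finset.range S.size, S.left r ⊗ₜ[B] ((S.right r * algebraMap A D a) ⊗ₜ[A] m) := h
    rw [RingHom.id_apply, Finset.smul_sum]
    simp only [TensorProduct.smul_tmul', Algebra.smul_def]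
    rw [h']
    refine Finset.sum_congr rfl fun r _ => ?_
    rw [TensorProduct.tmul_smul, TensorProduct.smul_tmul', Algebra.smul_def, mul_comm]

lemma unitHom_apply (M : Type) [AddCommGroup M] [Module A M] (m : M) :
    S.unitHom M m = ∑ r ∈ Finset.range S.size, S.left r ⊗ₜ[B] (S.right r ⊗ₜ[A] m) :=
  rfl

/-- The map `d ⊗ m ↦ θ(d) m`. -/
def formHom (N : Type) [AddCommGroup N] [Module B N] : D ⊗[B] N →ₗ[B] N :=
  TensorProduct.lift ((LinearMap.lsmul B N).comp S.form)

variable (A) in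
/-- The multiplication map `d ⊗ e ⊗ m ↦ d e ⊗ m`. -/
def mulHom (N : Type) [AddCommGroup N] [Module B N] : D ⊗[A] (D ⊗[B] N) →ₗ[D] D ⊗[B] N :=
  TensorProduct.AlgebraTensorModule.lift
    { toFun := fun d => (LinearMap.lsmul D (D ⊗[B] N) d).restrictScalars A
      map_add' := fun d e => by ext; simp
      map_smul' := fun d e => by ext; simp [mul_smul] }

/-- The pairing `d ⊗ e ⊗ m ↦ θ(d e) m`. -/
def counitHom (A : Type) [CommRing A] [Algebra A D] [SMulCommClass A B D] [SMulCommClass B A D]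
    (N : Type) [AddCommGroup N] [Module B N] : D ⊗[A] (D ⊗[B] N) →ₗ[B] N :=
  S.formHom N ∘ₗ (mulHom A N).restrictScalars B

lemma counitHom_tmul (N : Type) [AddCommGroup N] [Module B N] (d e : D) (m : N) :
    S.counitHom A N (d ⊗ₜ[A] (e ⊗ₜ[B] m)) = S.form (d * e) • m :=
  rfl

/-- The map `D ⊗ f`. -/
def mapHom {M N : Type} [AddCommGroup M] [Module A M] [AddCommGroup N] [Module A N]
    (f : M →ₗ[A] N) : D ⊗[A] M →ₗ[D] D ⊗[A] N :=
  TensorProduct.AlgebraTensorModule.map LinearMap.id f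

lemma mapHom_tmul {M N : Type} [AddCommGroup M] [Module A M] [AddCommGroup N] [Module A N]
    (f : M →ₗ[A] N) (d : D) (m : M) : mapHom f (d ⊗ₜ m) = d ⊗ₜ f m :=
  rfl

omit [SMulCommClass A B D] in
lemma induction_tmul_tmul (N : Type) [AddCommGroup N] [Module B N]
    {p : D ⊗[A] (D ⊗[B] N) → Prop} (x : D ⊗[A] (D ⊗[B] N)) (zero : p 0)
    (tmul : ∀ d e m, p (d ⊗ₜ (e ⊗ₜ m))) (add : ∀ x y, p x → p y → p (x + y)) : p x := by
  induction x using TensorProduct.induction_on with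
  | zero => exact zero
  | add x y hx hy => exact add x y hx hy
  | tmul d x =>
    induction x using TensorProduct.induction_on with
    | zero => rwa [TensorProduct.tmul_zero]
    | add x y hx hy => rw [TensorProduct.tmul_add]; exact add _ _ hx hy
    | tmul e m => exact tmul d e m

lemma unitHom_naturality {M N : Type} [AddCommGroup M] [Module A M] [AddCommGroup N] [Module A N]
    (f : M →ₗ[A] N) (m : M) :
    S.unitHom N (f m) = mapHom ((mapHom f : D ⊗[A] M →ₗ[D] _).restrictScalars B) (S.unitHom M m) := by
  rw [unitHom_apply, unitHom_apply, map_sum]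
  rfl

lemma counitHom_naturality {M N : Type} [AddCommGroup M] [Module B M] [AddCommGroup N]
    [Module B N] (f : M →ₗ[B] N) (x : D ⊗[A] (D ⊗[B] M)) :
    S.counitHom A N (mapHom ((mapHom f : D ⊗[B] M →ₗ[D] _).restrictScalars A) x) =
      f (S.counitHom A M x) := by
  induction x using induction_tmul_tmul with
  | zero => simp only [map_zero]
  | add x y hx hy => simp only [map_add, hx, hy]
  | tmul d e m =>
    rw [mapHom_tmul, LinearMap.restrictScalars_apply, mapHom_tmul, counitHom_tmul, counitHom_tmul,
      map_smul]

/-- One triangle identity, equivalent on pure tensors to `sum_form_mul_left`; the next lemma is the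
other one, from `sum_form_right_mul`. -/
lemma counitHom_mapHom_unitHom {M : Type} [AddCommGroup M] [Module A M] (x : D ⊗[A] M) :
    S.counitHom A (D ⊗[A] M) (mapHom (S.unitHom M) x) = x := by
  induction x using TensorProduct.induction_on with
  | zero => simp only [map_zero]
  | add x y hx hy => simp only [map_add, hx, hy]
  | tmul d m =>
    rw [mapHom_tmul, unitHom_apply, TensorProduct.tmul_sum, map_sum]
    simp only [counitHom_tmul, TensorProduct.smul_tmul']
    rw [← TensorProduct.sum_tmul, S.sum_form_mul_left]

lemma mapHom_counitHom_unitHom {N : Type} [AddCommGroup N] [Module B N] (x : D ⊗[B] N) :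
    mapHom (S.counitHom A N) (S.unitHom (D ⊗[B] N) x) = x := by
  induction x using TensorProduct.induction_on with
  | zero => simp only [map_zero]
  | add x y hx hy => simp only [map_add, hx, hy]
  | tmul d m =>
    rw [unitHom_apply, map_sum]
    simp only [mapHom_tmul, counitHom_tmul, TensorProduct.tmul_smul, TensorProduct.smul_tmul']
    rw [← TensorProduct.sum_tmul, S.sum_form_right_mul]

variable [Module.Finite A D] [Module.Finite B D]

instance finite_tensor (M : FGModuleCat.{0} A) : Module.Finite B (D ⊗[A] M) :=
  Module.Finite.trans D _

instance finite_tensor_tensor (M : FGModuleCat.{0} A) : Module.Finite A (D ⊗[B] (D ⊗[A] M)) :=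
  Module.Finite.trans D _

variable (A) in
/-- The adjunction between tensoring up from `A` to `D` (and restricting to `B`) and tensoring up
from `B` to `D` (and restricting to `A`) given by a Frobenius system for `D` over `B`. -/
def adjunction (S : FrobeniusSystem B D) : tensorFunctor A B D ⊣ tensorFunctor B A D where
  unit :=
    { app := fun M => (FGModuleCat.ofHom (S.unitHom M) :
        FGModuleCat.of A M ⟶ FGModuleCat.of A (D ⊗[B] (D ⊗[A] M)))
      naturality := fun _ _ f => FGModuleCat.hom_ext (LinearMap.ext fun m =>
        S.unitHom_naturality f.hom.hom m) }
  counit :=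
    { app := fun N => (FGModuleCat.ofHom (S.counitHom A N) :
        FGModuleCat.of B (D ⊗[A] (D ⊗[B] N)) ⟶ FGModuleCat.of B N)
      naturality := fun _ _ f => FGModuleCat.hom_ext (LinearMap.ext fun x =>
        S.counitHom_naturality f.hom.hom x) }
  left_triangle_components _ := FGModuleCat.hom_ext (LinearMap.ext fun x =>
    S.counitHom_mapHom_unitHom x)
  right_triangle_components _ := FGModuleCat.hom_ext (LinearMap.ext fun x =>
    S.mapHom_counitHom_unitHom x)

lemma adjunction_unit_app (M : FGModuleCat.{0} A) (m : M) :
    ((S.adjunction A).unit.app M).hom.hom m =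
      (∑ r ∈ Finset.range S.size, S.left r ⊗ₜ[B] (S.right r ⊗ₜ[A] m) : D ⊗[B] (D ⊗[A] M)) :=
  rfl

lemma adjunction_counit_app (N : FGModuleCat.{0} B) (d e : D) (m : N) :
    ((S.adjunction A).counit.app N).hom.hom (d ⊗ₜ[A] (e ⊗ₜ[B] m) : D ⊗[A] (D ⊗[B] N)) =
      S.form (d * e) • m :=
  rfl

/-- The value of the trace map at `z` for the unit given by a Casimir element and the counit given
by a linear form. -/
lemma trace_adjunction (S : FrobeniusSystem B D) (T : FrobeniusSystem A D) (z : B) :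
    (centreEquiv A).symm (trace (S.adjunction A) (T.adjunction B) (centreEquiv B z)) =
      T.form (algebraMap B D z * ∑ r ∈ Finset.range S.size, S.left r * S.right r) := by
  refine (centreEquiv A).symm_apply_eq.mpr ?_
  ext M m
  have h : (T.counitHom B M) (mapHom ((z • LinearMap.id : D ⊗[A] M →ₗ[B] D ⊗[A] M))
      (S.unitHom M m)) =
      T.form (algebraMap B D z * ∑ r ∈ Finset.range S.size, S.left r * S.right r) • m := by
    rw [unitHom_apply, map_sum, map_sum, Finset.mul_sum, map_sum, Finset.sum_smul]
    refine Finset.sum_congr rfl fun r _ => ?_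
    rw [mapHom_tmul, LinearMap.smul_apply, LinearMap.id_apply, TensorProduct.smul_tmul',
      counitHom_tmul, Algebra.smul_def, mul_left_comm]
  exact h

end FrobeniusSystem

/-! ### Extensions generated by a root of a split-off linear factor -/

/-- Elements `F_s` of `B` and `E_r`, `x` of a `B`-algebra `D` such that
`∑_s F_s t^s = (1 + x t) ∑_r E_r t^r`, where the last sum has degree at most `b` and the powers of
`x` span `D`. -/
structure LinearFactor (B D : Type) [CommRing B] [CommRing D] [Algebra B D] where
  /-- The split-off root, up to sign. -/
  x : D
  /-- The degree of the cofactor. -/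
  b : ℕ
  /-- The coefficients of the product. -/
  F : ℕ → B
  /-- The coefficients of the cofactor. -/
  E : ℕ → D
  F_zero : F 0 = 1
  E_zero : E 0 = 1
  E_of_lt : ∀ r, b < r → E r = 0
  algebraMap_F_succ : ∀ s, algebraMap B D (F (s + 1)) = E (s + 1) + x * E s
  mem_span : ∀ d, d ∈ Submodule.span B (Set.range fun j : ℕ => x ^ j)

namespace LinearFactor

variable {B D : Type} [CommRing B] [CommRing D] [Algebra B D] (S : LinearFactor B D)

/-- This is the coefficient of t^N in F(-t) (1 - x t)⁻¹ = E(-t), for the generating series F and E.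
-/
lemma sum_F_mul_pow (N : ℕ) :
    ∑ p ∈ Finset.HasAntidiagonal.antidiagonal N, (-1) ^ p.1 * algebraMap B D (S.F p.1) * S.x ^ p.2 =
      (-1) ^ N * S.E N := by
  induction N with
  | zero => simp [S.F_zero, S.E_zero]
  | succ N ih =>
    rw [Finset.Nat.sum_antidiagonal_succ', S.algebraMap_F_succ]
    simp only [pow_succ S.x, ← mul_assoc]
    rw [← Finset.sum_mul, ih]
    ring

/-- The partial sums of the Casimir element. -/
def casimirSum (N : ℕ) : D ⊗[B] D :=
  ∑ p ∈ Finset.HasAntidiagonal.antidiagonal N, ((-1) ^ p.1 * S.E p.1) ⊗ₜ[B] (S.x ^ p.2)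

lemma casimirSum_succ (N : ℕ) :
    S.casimirSum (N + 1) = S.casimirSum N * (1 ⊗ₜ S.x) + ((-1) ^ (N + 1) * S.E (N + 1)) ⊗ₜ 1 := by
  rw [casimirSum, Finset.Nat.sum_antidiagonal_succ', casimirSum, Finset.sum_mul, add_comm]
  simp only [Algebra.TensorProduct.tmul_mul_tmul, mul_one, pow_succ, pow_zero]

/-- Comparison with `casimirSum_succ` shows that x acting on the left and on the right of
`casimirSum N` differ only by terms in E_{N+1}. These vanish for N = b. -/
lemma x_mul_casimirSum (N : ℕ) :
    (S.x ⊗ₜ 1) * S.casimirSum N =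
      S.casimirSum (N + 1) - 1 ⊗ₜ ((-1) ^ (N + 1) * S.E (N + 1)) := by
  have h1 : (S.x ⊗ₜ 1) * S.casimirSum N = ∑ p ∈ Finset.HasAntidiagonal.antidiagonal N,
      ((1 : D) ⊗ₜ[B] ((-1) ^ p.1 * algebraMap B D (S.F (p.1 + 1)) * S.x ^ p.2) +
        ((-1) ^ (p.1 + 1) * S.E (p.1 + 1)) ⊗ₜ[B] (S.x ^ p.2)) := by
    rw [casimirSum, Finset.mul_sum]
    refine Finset.sum_congr rfl fun p _ => ?_
    -- The coefficients F lie in B and may cross the tensor sign; this lets x E_p = F_{p+1} -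
    -- E_{p+1} be used on the left and `sum_F_mul_pow` on the right.
    have h2 : (1 : D) ⊗ₜ[B] ((-1) ^ p.1 * algebraMap B D (S.F (p.1 + 1)) * S.x ^ p.2) =
        ((-1) ^ p.1 * algebraMap B D (S.F (p.1 + 1))) ⊗ₜ[B] (S.x ^ p.2) := by
      rw [show (-1 : D) ^ p.1 * algebraMap B D (S.F (p.1 + 1)) =
        ((-1) ^ p.1 * S.F (p.1 + 1)) • (1 : D) by simp [Algebra.smul_def], smul_mul_assoc, one_mul,
        TensorProduct.smul_tmul]
    rw [h2, ← TensorProduct.add_tmul, Algebra.TensorProduct.tmul_mul_tmul, one_mul,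
      S.algebraMap_F_succ]
    congr 1
    ring
  have h3 := S.sum_F_mul_pow (N + 1)
  rw [Finset.Nat.sum_antidiagonal_succ, S.F_zero, map_one, pow_zero, one_mul, one_mul] at h3
  have h4 : ∑ p ∈ Finset.HasAntidiagonal.antidiagonal N, (-1) ^ p.1 * algebraMap B D (S.F (p.1 + 1)) * S.x ^ p.2 =
      S.x ^ (N + 1) - (-1) ^ (N + 1) * S.E (N + 1) := by
    rw [← h3, sub_add_cancel_left, ← Finset.sum_neg_distrib]
    refine Finset.sum_congr rfl fun p _ => ?_
    ring
  rw [h1, Finset.sum_add_distrib, ← TensorProduct.tmul_sum, h4,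
    casimirSum, Finset.Nat.sum_antidiagonal_succ, S.E_zero, TensorProduct.tmul_sub]
  simp only [pow_zero, mul_one]
  abel

lemma mul_casimirSum (d : D) :
    (d ⊗ₜ 1) * S.casimirSum S.b = S.casimirSum S.b * (1 ⊗ₜ d) := by
  have hx : (S.x ⊗ₜ 1) * S.casimirSum S.b = S.casimirSum S.b * (1 ⊗ₜ S.x) := by
    rw [x_mul_casimirSum, casimirSum_succ, S.E_of_lt _ (Nat.lt_succ_self _)]
    simp
  refine Submodule.span_induction ?_ ?_ ?_ ?_ (S.mem_span d)
  · rintro _ ⟨j, rfl⟩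
    induction j with
    | zero => simp [← Algebra.TensorProduct.one_def]
    | succ j ih =>
      simp only at ih ⊢
      have h1 : (S.x ^ (j + 1)) ⊗ₜ[B] (1 : D) = (S.x ⊗ₜ 1) * ((S.x ^ j) ⊗ₜ 1) := by
        rw [Algebra.TensorProduct.tmul_mul_tmul, one_mul, pow_succ']
      have h2 : (1 : D) ⊗ₜ[B] (S.x ^ (j + 1)) = (1 ⊗ₜ S.x) * (1 ⊗ₜ (S.x ^ j)) := by
        rw [Algebra.TensorProduct.tmul_mul_tmul, one_mul, pow_succ']
      rw [h1, h2, mul_assoc, ih, ← mul_assoc, hx, mul_assoc]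
  · simp
  · intro d e _ _ hd he
    rw [TensorProduct.add_tmul, TensorProduct.tmul_add, add_mul, hd, he, mul_add]
  · intro a d _ hd
    rw [← TensorProduct.smul_tmul', TensorProduct.tmul_smul, smul_mul_assoc, hd, mul_smul_comm]

variable {θ : D →ₗ[B] B}

/-- In E_{r+1} x^t = F_{r+1} x^t - E_r x^{t+1} the first term is killed by θ because t < b. Under θ,
then, E_r may be traded for (-x)^r. -/
lemma form_E_mul_pow (h : ∀ j < S.b, θ (S.x ^ j) = 0) (r t : ℕ) (hrt : r + t ≤ S.b) :
    θ (S.E r * S.x ^ t) = if r + t = S.b then (-1) ^ r * θ (S.x ^ S.b) else 0 := by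
  induction r generalizing t with
  | zero =>
    rw [S.E_zero, one_mul, zero_add]
    split_ifs with ht
    · rw [ht, pow_zero, one_mul]
    · exact h t (by omega)
  | succ r ih =>
    have h1 : S.E (r + 1) * S.x ^ t = S.F (r + 1) • S.x ^ t - S.E r * S.x ^ (t + 1) := by
      rw [Algebra.smul_def, S.algebraMap_F_succ]
      ring
    rw [h1, map_sub, map_smul, h t (by omega), smul_zero, zero_sub, ih _ (by omega),
      show r + 1 + t = r + (t + 1) by ring]
    split_ifs
    · ring
    · exact neg_zero

/-- All b+1 terms have the same value. This later yields θ(x^b) by division, since the sum is a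
product of differences on which the form is known. -/
lemma form_sum_E_mul_pow (h : ∀ j < S.b, θ (S.x ^ j) = 0) :
    θ (∑ r ∈ Finset.range (S.b + 1), (-1) ^ r * S.E r * S.x ^ (S.b - r)) =
      (S.b + 1) * θ (S.x ^ S.b) := by
  rw [map_sum, Finset.sum_congr rfl (g := fun _ => θ (S.x ^ S.b))]
  · simp
  · intro r hr
    have hr' : r + (S.b - r) = S.b := by have := Finset.mem_range.mp hr; omega
    rw [mul_assoc, show (-1 : D) ^ r = algebraMap B D ((-1) ^ r) by simp, ← Algebra.smul_def,
      map_smul, S.form_E_mul_pow h _ _ hr'.le, if_pos hr', smul_eq_mul, ← mul_assoc, ← mul_pow]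
    simp

/-- The values of the form on powers of `x` are given by the inverse power series of
`∑_s (-1)^s F_s t^s`. -/
lemma form_pow_add (h : ∀ j < S.b, θ (S.x ^ j) = 0) {H : ℕ → B} (H0 : H 0 = 1)
    (hH : ∀ m, ∑ p ∈ Finset.HasAntidiagonal.antidiagonal (m + 1), (-1) ^ p.1 * S.F p.1 * H p.2 = 0) (m : ℕ) :
    θ (S.x ^ (S.b + m)) = θ (S.x ^ S.b) * H m := by
  induction m using Nat.strong_induction_on with
  | _ m ih =>
    rcases m with _ | m
    · rw [H0, mul_one, add_zero]
    -- Beyond degree b the right side is zero, which leaves a linear recursion for θ(x^j). The b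
    -- terms with exponent below b drop out, and what remains is the recursion `hH` for H.
    have h1 := congrArg θ (S.sum_F_mul_pow (S.b + (m + 1)))
    rw [S.E_of_lt _ (by omega), mul_zero, map_zero, map_sum] at h1
    have h2 : ∀ p : ℕ × ℕ, θ ((-1) ^ p.1 * algebraMap B D (S.F p.1) * S.x ^ p.2) =
        (-1) ^ p.1 * S.F p.1 * θ (S.x ^ p.2) := by
      intro p
      rw [show (-1 : D) ^ p.1 * algebraMap B D (S.F p.1) = algebraMap B D ((-1) ^ p.1 * S.F p.1) by
        simp, ← Algebra.smul_def, map_smul, smul_eq_mul]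
    simp only [h2] at h1
    rw [Finset.Nat.sum_antidiagonal_eq_sum_range_succ
      (fun s t => (-1) ^ s * S.F s * θ (S.x ^ t)), show (S.b + (m + 1)).succ = m + 2 + S.b by omega,
      Finset.sum_range_add, Finset.sum_eq_zero (s := Finset.range S.b), add_zero,
      Finset.sum_range_succ'] at h1
    · have h3 := hH m
      rw [Finset.Nat.sum_antidiagonal_eq_sum_range_succ
        (fun s t => (-1) ^ s * S.F s * H t), Finset.sum_range_succ'] at h3
      simp only [pow_zero, one_mul, S.F_zero, Nat.sub_zero] at h1 h3
      have h4 : ∑ k ∈ Finset.range (m + 1), (-1) ^ (k + 1) * S.F (k + 1) *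
          θ (S.x ^ (S.b + (m + 1) - (k + 1))) = θ (S.x ^ S.b) *
            ∑ k ∈ Finset.range (m + 1), (-1) ^ (k + 1) * S.F (k + 1) * H (m + 1 - (k + 1)) := by
        rw [Finset.mul_sum]
        refine Finset.sum_congr rfl fun k hk => ?_
        have hk' := Finset.mem_range.mp hk
        rw [show S.b + (m + 1) - (k + 1) = S.b + (m + 1 - (k + 1)) by omega, ih _ (by omega)]
        ring
      linear_combination h1 - h4 - θ (S.x ^ S.b) * h3
    · intro r hr
      have := Finset.mem_range.mp hr
      rw [h _ (by omega), mul_zero]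

/-- The Frobenius system attached to a form that vanishes on all powers of `x` below the `b`th and
takes a value `u` with `u * u = 1` there. -/
def frobeniusSystem (θ : D →ₗ[B] B) (h : ∀ j < S.b, θ (S.x ^ j) = 0) (u : B)
    (hu : θ (S.x ^ S.b) = u) (huu : u * u = 1) : FrobeniusSystem B D where
  form := θ
  size := S.b + 1
  left r := algebraMap B D u * ((-1) ^ r * S.E r)
  right r := S.x ^ (S.b - r)
  casimir d := by
    have hc := S.mul_casimirSum d
    rw [casimirSum, Finset.Nat.sum_antidiagonal_eq_sum_range_succ
      (fun s t => ((-1) ^ s * S.E s) ⊗ₜ[B] (S.x ^ t)), Finset.mul_sum, Finset.sum_mul] at hc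
    simp only [Algebra.TensorProduct.tmul_mul_tmul, mul_one, one_mul] at hc
    simp only [← Algebra.smul_def u, mul_smul_comm, ← TensorProduct.smul_tmul']
    rw [← Finset.smul_sum, ← Finset.smul_sum, ← hc]
  form_left := by
    -- Only r = b survives, with right factor x^0. Its two signs (-1)^b cancel, and so do the two
    -- factors u.
    rw [Finset.sum_range_succ, Finset.sum_eq_zero, zero_add]
    · have h1 := S.form_E_mul_pow h S.b 0 (by omega)
      rw [pow_zero, mul_one, add_zero, if_pos rfl] at h1
      rw [← mul_assoc, show algebraMap B D u * (-1) ^ S.b = algebraMap B D (u * (-1) ^ S.b) by simp,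
        ← Algebra.smul_def, map_smul, h1, hu, smul_eq_mul, Nat.sub_self, pow_zero, mul_mul_mul_comm,
        mul_comm u, mul_assoc, mul_left_comm u, huu, mul_one, ← mul_pow, neg_one_mul, neg_neg,
        one_pow, one_smul]
    · intro r hr
      have hr' := Finset.mem_range.mp hr
      have h1 := S.form_E_mul_pow h r 0 (by omega)
      rw [pow_zero, mul_one, add_zero, if_neg hr'.ne] at h1
      rw [← mul_assoc, show algebraMap B D u * (-1) ^ r = algebraMap B D (u * (-1) ^ r) by simp,
        ← Algebra.smul_def, map_smul, h1, smul_zero, zero_smul]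
  form_right := by
    rw [Finset.sum_range_succ', Finset.sum_eq_zero, zero_add]
    · rw [pow_zero, one_mul, S.E_zero, mul_one, Nat.sub_zero, hu, Algebra.smul_def, ← map_mul, huu,
        map_one]
    · intro r hr
      have hr' := Finset.mem_range.mp hr
      rw [h _ (by omega), zero_smul]

end LinearFactor

/-! ### Elementary and complete symmetric polynomials -/

lemma mk_neg_one_pow_mul_esymm (σ : Type*) [Fintype σ] [DecidableEq σ] :
    (PowerSeries.mk fun r => (-1) ^ r * MvPolynomial.esymm σ ℂ r) =
      ∏ p : σ, (1 - PowerSeries.C (MvPolynomial.X p : MvPolynomial σ ℂ) * PowerSeries.X) := by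
  ext1 r
  simp only [sub_eq_add_neg]
  rw [PowerSeries.coeff_mk, Finset.prod_one_add, map_sum, MvPolynomial.esymm, Finset.mul_sum,
    Finset.powersetCard_eq_filter, Finset.sum_filter]
  refine Finset.sum_congr rfl fun t _ => ?_
  rw [Finset.prod_neg, Finset.prod_mul_distrib, Finset.prod_const, ← map_prod,
    ← map_one PowerSeries.C, ← map_neg, ← map_pow, ← mul_assoc, ← map_mul,
    PowerSeries.coeff_C_mul, PowerSeries.coeff_X_pow]
  by_cases h : t.card = r
  · rw [if_pos h, if_pos h.symm, mul_one, h]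
  · rw [if_neg h, if_neg (Ne.symm h), mul_zero]

lemma mk_hsymm (σ : Type*) [Fintype σ] [DecidableEq σ] :
    (PowerSeries.mk fun r => MvPolynomial.hsymm σ ℂ r) =
      ∏ p : σ, PowerSeries.mk fun j => (MvPolynomial.X p : MvPolynomial σ ℂ) ^ j := by
  ext1 r
  rw [PowerSeries.coeff_mk, PowerSeries.coeff_prod, MvPolynomial.hsymm]
  refine Finset.sum_bij' (fun s _ => Multiset.toFinsupp (s : Multiset σ))
    (fun l hl => ⟨Finsupp.toMultiset l, ?_⟩) ?_ ?_ ?_ ?_ ?_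
  · rw [Finsupp.card_toMultiset, Finsupp.sum_fintype _ _ fun _ => rfl]
    exact (Finset.mem_finsuppAntidiag.mp hl).1
  · intro s _
    refine Finset.mem_finsuppAntidiag.mpr ⟨?_, Finset.subset_univ _⟩
    exact (Multiset.sum_count_eq_card fun _ _ => Finset.mem_univ _).trans s.2
  · exact fun _ _ => Finset.mem_univ _
  · exact fun s _ => Subtype.ext (Multiset.toFinsupp_toMultiset _)
  · exact fun l _ => Finsupp.toMultiset_toFinsupp l
  · intro s _
    simp only [PowerSeries.coeff_mk, Multiset.toFinsupp_apply]
    rw [Finset.prod_multiset_map_count]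
    refine Finset.prod_subset (Finset.subset_univ _) fun p _ hp => ?_
    rw [Multiset.mem_toFinset] at hp
    rw [Multiset.count_eq_zero_of_notMem hp, pow_zero]

/-- The generating series are ∏ (1 - x_p t) and the product of the geometric series of the x_p t, so
they are inverse to each other. -/
lemma sum_esymm_mul_hsymm (σ : Type*) [Fintype σ] [DecidableEq σ] (m : ℕ) :
    ∑ p ∈ Finset.HasAntidiagonal.antidiagonal (m + 1),
      (-1) ^ p.1 * MvPolynomial.esymm σ ℂ p.1 * MvPolynomial.hsymm σ ℂ p.2 = 0 := by
  have h : (PowerSeries.mk fun r => (-1) ^ r * MvPolynomial.esymm σ ℂ r) *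
      (PowerSeries.mk fun r => MvPolynomial.hsymm σ ℂ r) = 1 := by
    rw [mk_neg_one_pow_mul_esymm, mk_hsymm, ← Finset.prod_mul_distrib]
    refine Finset.prod_eq_one fun p _ => ?_
    ext1 j
    rw [sub_mul, one_mul, map_sub, mul_assoc, PowerSeries.coeff_C_mul, PowerSeries.coeff_mk]
    rcases j with _ | j
    · simp
    · rw [PowerSeries.coeff_succ_X_mul, PowerSeries.coeff_mk, pow_succ', sub_self,
        PowerSeries.coeff_one, if_neg (Nat.succ_ne_zero j)]
  have h2 := congrArg (PowerSeries.coeff (m + 1)) h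
  rw [PowerSeries.coeff_mul, PowerSeries.coeff_one, if_neg (Nat.succ_ne_zero m)] at h2
  simpa using h2

/-- The `r`th elementary symmetric polynomial in the variables from a set of positions. -/
def esym (s : Finset (Fin n)) (r : ℕ) : MvPolynomial (Fin n) ℂ :=
  ∑ t ∈ s.powersetCard r, ∏ p ∈ t, MvPolynomial.X p

lemma esym_zero (s : Finset (Fin n)) : esym s 0 = 1 := by simp [esym]

lemma esym_of_card_lt {s : Finset (Fin n)} {r : ℕ} (h : s.card < r) : esym s r = 0 := by
  rw [esym, Finset.powersetCard_eq_empty.mpr h, Finset.sum_empty]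

lemma esym_insert {s : Finset (Fin n)} {k : Fin n} (hk : k ∉ s) (r : ℕ) :
    esym (insert k s) (r + 1) = esym s (r + 1) + MvPolynomial.X k * esym s r := by
  have hmem : ∀ {j : ℕ} {t : Finset (Fin n)}, t ∈ s.powersetCard j → k ∉ t :=
    fun ht hkt => hk ((Finset.mem_powersetCard.mp ht).1 hkt)
  rw [esym, Finset.powersetCard_succ_insert hk, Finset.sum_union, Finset.sum_image, esym, esym,
    Finset.mul_sum]
  · congr 1
    exact Finset.sum_congr rfl fun t ht => Finset.prod_insert (hmem ht)
  · intro t ht t' ht' htt'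
    rw [← Finset.erase_insert (hmem ht), htt', Finset.erase_insert (hmem ht')]
  · rw [Finset.disjoint_left]
    intro t ht ht'
    obtain ⟨t', _, rfl⟩ := Finset.mem_image.mp ht'
    exact hmem ht (Finset.mem_insert_self _ _)

lemma prod_sub_eq_sum_esym (s : Finset (Fin n)) {R : Type*} [CommRing R]
    (φ : MvPolynomial (Fin n) ℂ →+* R) (T : R) :
    ∏ q ∈ s, (T - φ (MvPolynomial.X q)) =
      ∑ r ∈ Finset.range (s.card + 1), (-1) ^ r * φ (esym s r) * T ^ (s.card - r) := by
  simp only [sub_eq_neg_add]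
  rw [Finset.prod_add, Finset.sum_powerset]
  refine Finset.sum_congr rfl fun r _ => ?_
  rw [esym, map_sum, Finset.mul_sum, Finset.sum_mul]
  refine Finset.sum_congr rfl fun t ht => ?_
  have ht' := Finset.mem_powersetCard.mp ht
  rw [Finset.prod_const, Finset.card_sdiff_of_subset ht'.1, Finset.prod_neg, ht'.2, map_prod]

lemma rename_esymm_subtype (P : Fin n → Prop) [DecidablePred P] (r : ℕ) :
    MvPolynomial.rename Subtype.val (MvPolynomial.esymm {p // P p} ℂ r) =
      esym (Finset.univ.filter P) r := by
  have h : (Finset.univ : Finset {p // P p}).map (Function.Embedding.subtype P) =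
      Finset.univ.filter P := by
    ext p; simp
  rw [esym, ← h, Finset.powersetCard_map, Finset.sum_map, MvPolynomial.esymm, map_sum]
  refine Finset.sum_congr rfl fun t _ => ?_
  simp [map_prod]

lemma val_e (ν : Comp n) (r : ℕ) (i : ℤ) :
    PCoinv.val ν (e ν r i) = toCoinv n (esym (Finset.univ.filter fun p => colour ν p = i) r) := by
  rw [← rename_esymm_subtype]
  rfl

lemma e_zero (ν : Comp n) (i : ℤ) : e ν 0 i = 1 := by
  refine PCoinv.val_injective ν ?_
  rw [val_e, esym_zero, map_one, map_one]

lemma val_h (ν : Comp n) (m : ℕ) (i : ℤ) :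
    PCoinv.val ν (h ν m i) = toCoinv n (MvPolynomial.rename Subtype.val
      (MvPolynomial.hsymm {p : Fin n // colour ν p = i} ℂ m)) :=
  congrArg (PCoinv.val ν) (if_neg (Int.natCast_nonneg m).not_gt : h ν m i = _)

lemma h_zero (ν : Comp n) (i : ℤ) : h ν 0 i = 1 := by
  refine PCoinv.val_injective ν ?_
  rw [← Nat.cast_zero, val_h, MvPolynomial.hsymm_zero, map_one, map_one, map_one]

lemma h_of_neg (ν : Comp n) {r : ℤ} (hr : r < 0) (i : ℤ) : h ν r i = 0 := if_pos hr

lemma sum_e_mul_h (ν : Comp n) (i : ℤ) (m : ℕ) :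
    ∑ p ∈ Finset.HasAntidiagonal.antidiagonal (m + 1), (-1) ^ p.1 * e ν p.1 i * h ν p.2 i = 0 := by
  refine PCoinv.val_injective ν ?_
  have h1 := congrArg (fun f => toCoinv n (MvPolynomial.rename Subtype.val f))
    (sum_esymm_mul_hsymm {p : Fin n // colour ν p = i} m)
  simp only [map_sum, map_mul, map_pow, map_neg, map_one, map_zero] at h1 ⊢
  rw [← h1]
  refine Finset.sum_congr rfl fun p _ => ?_
  rw [val_h]
  rfl

/-! ### Splitting a position off its block -/

/-- The other positions in the block of the position `k`. -/
def others (μ : Comp n) (k : Fin n) : Finset (Fin n) := {q | q ≠ k ∧ colour μ q = colour μ k}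

lemma mem_others {μ : Comp n} {k q : Fin n} :
    q ∈ others μ k ↔ q ≠ k ∧ colour μ q = colour μ k := by
  simp [others]

lemma insert_others (μ : Comp n) (k : Fin n) :
    insert k (others μ k) = Finset.univ.filter fun p => colour μ p = colour μ k := by
  ext p
  rw [Finset.mem_insert, mem_others, Finset.mem_filter]
  by_cases h : p = k <;> simp [h]

lemma notMem_others (μ : Comp n) (k : Fin n) : k ∉ others μ k := fun h => (mem_others.mp h).1 rfl

/-- The product of all `x_p - x_q` with `p < q` in the same block and different from `k`. -/
def vandAway (μ : Comp n) (k : Fin n) : MvPolynomial (Fin n) ℂ :=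
  ∏ pq : Fin n × Fin n with
    (pq.1 < pq.2 ∧ colour μ pq.1 = colour μ pq.2) ∧ pq.1 ≠ k ∧ pq.2 ≠ k,
    (MvPolynomial.X pq.1 - MvPolynomial.X pq.2)

/-- The product of all `x_k - x_q` with `q ≠ k` in the block of `k`. -/
def cross (μ : Comp n) (k : Fin n) : MvPolynomial (Fin n) ℂ :=
  ∏ q ∈ others μ k, (MvPolynomial.X k - MvPolynomial.X q)

/-- The sign `(-1)^j`, where `j` is the number of positions before `k` in the block of `k`. -/
def crossSign (μ : Comp n) (k : Fin n) : ℂ := (-1) ^ ((others μ k).filter (· < k)).card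

lemma crossSign_mul_self (μ : Comp n) (k : Fin n) : crossSign μ k * crossSign μ k = 1 := by
  rw [crossSign, ← mul_pow]; simp

lemma vand_eq (μ : Comp n) (k : Fin n) :
    vand μ = crossSign μ k • (vandAway μ k * cross μ k) := by
  -- A pair containing k is named by its other member q; the factors with q before k are those that
  -- `cross` takes with the opposite sign.
  have h1 : ∏ pq : Fin n × Fin n with
      (pq.1 < pq.2 ∧ colour μ pq.1 = colour μ pq.2) ∧ ¬(pq.1 ≠ k ∧ pq.2 ≠ k),
      (MvPolynomial.X pq.1 - MvPolynomial.X pq.2 : MvPolynomial (Fin n) ℂ) =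
      ∏ q ∈ others μ k, if q < k then (MvPolynomial.X q - MvPolynomial.X k)
        else (MvPolynomial.X k - MvPolynomial.X q) := by
    symm
    refine Finset.prod_bij' (fun q _ => if q < k then (q, k) else (k, q))
      (fun pq _ => if pq.1 = k then pq.2 else pq.1) ?_ ?_ ?_ ?_ ?_
    · intro q hq
      have hq' := mem_others.mp hq
      simp only [Finset.mem_filter, Finset.mem_univ, true_and]
      split_ifs with h
      · exact ⟨⟨h, hq'.2⟩, by simp⟩
      · exact ⟨⟨lt_of_le_of_ne (not_lt.mp h) hq'.1.symm, hq'.2.symm⟩, by simp⟩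
    · rintro ⟨p, q⟩ hpq
      simp only [Finset.mem_filter, Finset.mem_univ, true_and, not_and_or, not_not] at hpq
      rw [mem_others]
      split_ifs with h
      · subst h; exact ⟨hpq.1.1.ne', hpq.1.2.symm⟩
      · have := hpq.2.resolve_left h
        subst this; exact ⟨h, hpq.1.2⟩
    · intro q hq
      have hq' := mem_others.mp hq
      split_ifs <;> simp_all
    · rintro ⟨p, q⟩ hpq
      simp only [Finset.mem_filter, Finset.mem_univ, true_and, not_and_or, not_not] at hpq
      simp only
      by_cases h : p = k
      · subst h
        rw [if_pos rfl, if_neg (not_lt.mpr hpq.1.1.le)]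
      · have := hpq.2.resolve_left h
        subst this
        rw [if_neg h, if_pos hpq.1.1]
    · intro q _
      split_ifs <;> rfl
  rw [vand, ← Finset.prod_filter_mul_prod_filter_not _ fun pq : Fin n × Fin n => pq.1 ≠ k ∧ pq.2 ≠ k,
    Finset.filter_filter, Finset.filter_filter, h1, vandAway, ← mul_smul_comm]
  congr 1
  have h2 : ∀ q, (if q < k then (MvPolynomial.X q - MvPolynomial.X k : MvPolynomial (Fin n) ℂ)
      else (MvPolynomial.X k - MvPolynomial.X q)) =
      (if q < k then -1 else 1) * (MvPolynomial.X k - MvPolynomial.X q) := by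
    intro q; split_ifs <;> ring
  simp only [h2]
  rw [Finset.prod_mul_distrib, ← Finset.prod_filter, Finset.prod_const, cross, crossSign,
    MvPolynomial.smul_eq_C_mul]
  simp

/-- The elements of `S_μ` that fix `k`. -/
def stabFin (μ : Comp n) (k : Fin n) : Finset (Equiv.Perm (Fin n)) := {w ∈ parFin μ | w k = k}

lemma mem_stabFin {μ : Comp n} {k : Fin n} {w : Equiv.Perm (Fin n)} :
    w ∈ stabFin μ k ↔ w ∈ parFin μ ∧ w k = k := by
  simp [stabFin]

lemma card_stabFin_ne_zero (μ : Comp n) (k : Fin n) : ((stabFin μ k).card : ℂ) ≠ 0 :=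
  Nat.cast_ne_zero.mpr (Finset.card_ne_zero.mpr
    ⟨1, mem_stabFin.mpr ⟨mem_parFin.mpr fun _ => rfl, rfl⟩⟩)

lemma mul_mem_parFin {μ : Comp n} {u w : Equiv.Perm (Fin n)} (hu : u ∈ parFin μ)
    (hw : w ∈ parFin μ) : u * w ∈ parFin μ :=
  mem_parFin_iff.mpr (mul_mem (mem_parFin_iff.mp hu) (mem_parFin_iff.mp hw))

/-- Orbit-stabilizer: the orbit of k is its block, and the transposition of q and k carries the
fibre over q to the stabilizer. -/
lemma card_parFin_eq (μ : Comp n) (k : Fin n) :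
    (parFin μ).card = ((others μ k).card + 1) * (stabFin μ k).card := by
  rw [← Finset.card_insert_of_notMem (notMem_others μ k), insert_others,
    Finset.card_eq_sum_card_fiberwise (f := fun w => w k)
      (t := Finset.univ.filter fun p => colour μ p = colour μ k), Finset.sum_const_nat]
  · intro q hq
    have hq' := (Finset.mem_filter.mp hq).2
    refine Finset.card_bij' (fun w _ => Equiv.swap q k * w) (fun w _ => Equiv.swap q k * w)
      ?_ ?_ ?_ ?_
    · intro w hw
      rw [Finset.mem_filter] at hw
      exact mem_stabFin.mpr ⟨mul_mem_parFin (swap_mem_parFin hq') hw.1, by simp [hw.2]⟩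
    · intro w hw
      rw [mem_stabFin] at hw
      exact Finset.mem_filter.mpr ⟨mul_mem_parFin (swap_mem_parFin hq') hw.1, by simp [hw.2]⟩
    · intro w _; simp [← mul_assoc]
    · intro w _; simp [← mul_assoc]
  · intro w hw
    simpa using mem_parFin.mp hw k

lemma rename_cross {μ : Comp n} {k : Fin n} {w : Equiv.Perm (Fin n)} (hw : w ∈ stabFin μ k) :
    MvPolynomial.rename w (cross μ k) = cross μ k := by
  rw [mem_stabFin] at hw
  rw [cross, map_prod]
  refine Finset.prod_equiv w (fun q => ?_) fun q _ => ?_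
  · have h : w q = k ↔ q = k := by
      conv_lhs => rw [← hw.2]
      exact w.injective.eq_iff
    rw [mem_others, mem_others, mem_parFin.mp hw.1, ne_eq, ne_eq, h]
  · rw [map_sub, MvPolynomial.rename_X, MvPolynomial.rename_X, hw.2]

lemma cross_ne_zero (μ : Comp n) (k : Fin n) : cross μ k ≠ 0 :=
  Finset.prod_ne_zero_iff.mpr fun _ hq => X_sub_X_ne_zero (mem_others.mp hq).1.symm

lemma rename_vandAway {μ : Comp n} {k : Fin n} {w : Equiv.Perm (Fin n)} (hw : w ∈ stabFin μ k) :
    MvPolynomial.rename w (vandAway μ k) = sgn w • vandAway μ k := by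
  have h := rename_vand (mem_stabFin.mp hw).1
  rw [vand_eq μ k, map_smul, map_mul, rename_cross hw, smul_comm] at h
  refine mul_right_cancel₀ (cross_ne_zero μ k) ?_
  rw [smul_mul_assoc]
  exact smul_right_injective _ (left_ne_zero_of_mul_eq_one (crossSign_mul_self μ k)) h

/-- Lagrange interpolation: invariants of the stabilizer of `k` are combinations of powers of `x_k`
with coefficients invariant under `S_μ`. -/
lemma card_smul_eq_sum {μ : Comp n} {k : Fin n} {f : MvPolynomial (Fin n) ℂ}
    (hf : ∀ w ∈ stabFin μ k, MvPolynomial.rename w f = f) :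
    ((stabFin μ k).card : ℂ) • f = ∑ r ∈ Finset.range ((others μ k).card + 1),
      divDiff μ (crossSign μ k • (-1) ^ r * (vandAway μ k * f * esym (others μ k) r)) *
        MvPolynomial.X k ^ ((others μ k).card - r) := by
  -- If w moves k, the factor with w q = k vanishes; if w fixes k, the summand does not depend on w.
  -- Expanding the product in powers of x_k turns the sum over w into antisymmetrizations.
  have h1 : ∑ w ∈ parFin μ, sgn w • MvPolynomial.rename w (vandAway μ k * f) *
      ∏ q ∈ others μ k, (MvPolynomial.X k - MvPolynomial.X (w q)) =
      ((stabFin μ k).card : ℂ) • (vandAway μ k * f * cross μ k) := by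
    rw [← Finset.sum_subset (s₁ := stabFin μ k) (Finset.filter_subset _ _),
      Finset.sum_congr rfl (g := fun _ => vandAway μ k * f * cross μ k), Finset.sum_const,
      Nat.cast_smul_eq_nsmul]
    · intro w hw
      rw [map_mul, rename_vandAway hw, hf w hw, smul_mul_assoc, smul_mul_assoc, smul_mul_assoc, smul_smul, sgn_mul_self, one_smul,
        ← rename_cross hw, cross, map_prod]
      simp [(mem_stabFin.mp hw).2]
    · intro w hw hw'
      have hk : w k ≠ k := fun h => hw' (mem_stabFin.mpr ⟨hw, h⟩)
      rw [Finset.prod_eq_zero (i := w⁻¹ k), mul_zero]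
      · rw [mem_others]
        refine ⟨fun h => hk ?_, ?_⟩
        · rw [Equiv.Perm.inv_eq_iff_eq] at h; exact h.symm
        · rw [← mem_parFin.mp hw (w⁻¹ k)]; simp
      · simp
  refine mul_left_cancel₀ (vand_ne_zero μ) ?_
  rw [mul_smul_comm, Finset.mul_sum]
  have h2 : vand μ * f = crossSign μ k • (vandAway μ k * f * cross μ k) := by
    rw [vand_eq μ k, smul_mul_assoc]; ring_nf
  rw [h2, smul_comm, ← h1, Finset.smul_sum]
  simp only [← mul_assoc (vand μ), vand_mul_divDiff, antisym_apply, Finset.sum_mul]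
  rw [Finset.sum_comm]
  refine Finset.sum_congr rfl fun w _ => ?_
  have h3 := prod_sub_eq_sum_esym (others μ k) (MvPolynomial.rename (R := ℂ) w).toRingHom
    (MvPolynomial.X k)
  simp only [AlgHom.toRingHom_eq_coe, RingHom.coe_coe, MvPolynomial.rename_X] at h3
  rw [h3, Finset.mul_sum, Finset.smul_sum]
  refine Finset.sum_congr rfl fun r _ => ?_
  simp only [map_mul, map_pow, map_neg, map_one, MvPolynomial.smul_eq_C_mul,
    MvPolynomial.rename_C]
  ring

lemma totalDegree_cross (μ : Comp n) (k : Fin n) :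
    (cross μ k).totalDegree = (others μ k).card := by
  have h : (cross μ k).IsHomogeneous (∑ _q ∈ others μ k, 1) :=
    MvPolynomial.IsHomogeneous.prod _ _ _ fun q _ =>
      (MvPolynomial.isHomogeneous_X _ _).sub (MvPolynomial.isHomogeneous_X _ _)
  rw [h.totalDegree (cross_ne_zero μ k), Finset.card_eq_sum_ones]

lemma vandAway_ne_zero (μ : Comp n) (k : Fin n) : vandAway μ k ≠ 0 :=
  Finset.prod_ne_zero_iff.mpr fun _ hpq => X_sub_X_ne_zero (Finset.mem_filter.mp hpq).2.1.1.ne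

/-- A degree argument: the antisymmetrization is divisible by Δ times `cross`, whose degree deg Δ +
b exceeds its own bound deg Δ + j. -/
lemma divDiff_vandAway_mul_pow {μ : Comp n} {k : Fin n} {j : ℕ} (hj : j < (others μ k).card) :
    divDiff μ (vandAway μ k * MvPolynomial.X k ^ j) = 0 := by
  refine (mul_eq_zero.mp ((vand_mul_divDiff μ _).trans ?_)).resolve_left (vand_ne_zero μ)
  by_contra hne
  have hdvd : vandAway μ k * cross μ k ∣ antisym μ (vandAway μ k * MvPolynomial.X k ^ j) := by
    refine Dvd.dvd.trans ⟨MvPolynomial.C (crossSign μ k), ?_⟩ (vand_dvd_antisym μ _)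
    rw [vand_eq μ k, MvPolynomial.smul_eq_C_mul, mul_comm]
  have h1 := MvPolynomial.totalDegree_le_of_dvd_of_isDomain hdvd hne
  rw [MvPolynomial.totalDegree_mul_of_isDomain (vandAway_ne_zero μ k) (cross_ne_zero μ k),
    totalDegree_cross] at h1
  have h2 : (antisym μ (vandAway μ k * MvPolynomial.X k ^ j)).totalDegree ≤
      (vandAway μ k).totalDegree + j := by
    rw [antisym_apply]
    refine MvPolynomial.totalDegree_finsetSum_le fun w _ => ?_
    refine (MvPolynomial.totalDegree_smul_le _ _).trans
      ((MvPolynomial.totalDegree_rename_le _ _).trans ((MvPolynomial.totalDegree_mul _ _).trans ?_))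
    rw [MvPolynomial.totalDegree_X_pow]
  omega

/-! ### The linear form attached to a position -/

/-- The linear form `C → C_μ`, `c ↦ |H|⁻¹ ∂_μ(Δ c)`, where `H` is the stabilizer of `k` in `S_μ` and
`Δ` is the product of all `x_p - x_q` with `p < q` in the same block and different from `k`. -/
def coinvForm (μ : Comp n) (k : Fin n) : Coinv n →ₗ[ℂ] PCoinv μ :=
  ((stabFin μ k).card : ℂ)⁻¹ • coinvDivDiff μ ∘ₗ LinearMap.mulLeft ℂ (toCoinv n (vandAway μ k))

lemma coinvForm_apply (μ : Comp n) (k : Fin n) (c : Coinv n) :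
    coinvForm μ k c =
      ((stabFin μ k).card : ℂ)⁻¹ • coinvDivDiff μ (toCoinv n (vandAway μ k) * c) :=
  rfl

lemma coinvForm_val_mul (μ : Comp n) (k : Fin n) (z : PCoinv μ) (c : Coinv n) :
    coinvForm μ k (PCoinv.val μ z * c) = z * coinvForm μ k c := by
  rw [coinvForm_apply, coinvForm_apply, mul_left_comm, coinvDivDiff_val_mul, mul_smul_comm]

lemma coinvForm_pow {μ : Comp n} {k : Fin n} {j : ℕ} (hj : j < (others μ k).card) :
    coinvForm μ k (toCoinv n (MvPolynomial.X k) ^ j) = 0 := by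
  rw [coinvForm_apply, ← map_pow, ← map_mul]
  convert smul_zero _
  refine PCoinv.val_injective μ ?_
  rw [coinvDivDiff_toCoinv, divDiff_vandAway_mul_pow hj, map_zero, map_zero]

/-- Δ times `cross ρ k` is ±|S_ρ| ε_ρ, and |S_ρ| / |H| is the size of the block of k in ρ. The case
ρ = μ normalizes the form; the case ρ ≠ μ computes the traces. -/
lemma coinvForm_cross_mul {μ ρ : Comp n} {k : Fin n} (hv : vandAway ρ k = vandAway μ k)
    (hs : stabFin ρ k = stabFin μ k) (c : Coinv n) :
    coinvForm μ k (toCoinv n (cross ρ k) * c) =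
      (crossSign ρ k * ((others ρ k).card + 1)) • coinvDivDiff μ (eps ρ * c) := by
  have h := congrArg (Nat.cast (R := ℂ)) (card_parFin_eq ρ k)
  push_cast at h
  have h1 := card_stabFin_ne_zero ρ k
  have h3 : ((others ρ k).card + 1 : ℂ) ≠ 0 := by
    exact_mod_cast Nat.succ_ne_zero (others ρ k).card
  rw [eps_eq, coinvForm_apply, vand_eq ρ k, map_smul, map_mul (toCoinv n), smul_mul_assoc,
    smul_mul_assoc, map_smul, map_smul, smul_smul, smul_smul,
    mul_assoc (toCoinv n (vandAway ρ k)), h, hv, ← hs]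
  congr 1
  have h4 := crossSign_mul_self ρ k
  field_simp
  rw [sq, h4]

/-- Invariants under the stabilizer of `k` in the coinvariant algebra are spanned over `C_μ` by the
powers of `x_k`. -/
lemma exists_eq_sum_val_mul_pow {μ : Comp n} {k : Fin n} {G : Subgroup (Equiv.Perm (Fin n))}
    (hG : ∀ w, w ∈ G ↔ w ∈ stabFin μ k) {c : Coinv n} (hc : c ∈ inv G) :
    ∃ (N : ℕ) (z : ℕ → PCoinv μ) (s : ℕ → ℕ),
      c = ∑ r ∈ Finset.range N, PCoinv.val μ (z r) * toCoinv n (MvPolynomial.X k) ^ s r := by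
  obtain ⟨f, rfl, hf⟩ := exists_invariant_lift hc
  have h := congrArg (toCoinv n) (card_smul_eq_sum fun w hw => hf w ((hG w).mpr hw))
  rw [map_smul, ← eq_inv_smul_iff₀ (card_stabFin_ne_zero μ k), map_sum, Finset.smul_sum] at h
  refine ⟨_, fun r => ((stabFin μ k).card : ℂ)⁻¹ • coinvDivDiff μ (toCoinv n
    (crossSign μ k • (-1) ^ r * (vandAway μ k * f * esym (others μ k) r))),
    fun r => (others μ k).card - r, h.trans (Finset.sum_congr rfl fun r _ => ?_)⟩
  rw [map_smul, coinvDivDiff_toCoinv, map_mul (toCoinv n), map_pow]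
  exact (smul_mul_assoc _ _ _).symm

/-! ### The Frobenius system of a position -/

/-- A model `D` for the invariants in `C` of the stabilizer of a position `k` in `S_μ`, together
with names for the relevant elements and numbers. -/
structure SplitModel (μ : Comp n) (k : Fin n) (D : Type) [CommRing D] [Algebra (PCoinv μ) D] where
  /-- The stabilizer. -/
  G : Subgroup (Equiv.Perm (Fin n))
  mem_G : ∀ w, w ∈ G ↔ w ∈ stabFin μ k
  /-- The inclusion into `C`. -/
  val : D →+* Coinv n
  val_injective : Function.Injective val
  val_algebraMap : ∀ z, val (algebraMap (PCoinv μ) D z) = PCoinv.val μ z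
  val_mem : ∀ d, val d ∈ inv G
  /-- The variable in position `k`. -/
  x : D
  val_x : val x = toCoinv n (MvPolynomial.X k)
  /-- The index of the block of `k`. -/
  i : ℤ
  colour_k : colour μ k = i
  /-- The number of other positions in the block. -/
  b : ℕ
  card_others : (others μ k).card = b
  /-- The elementary symmetric polynomials in the other variables of the block. -/
  E : ℕ → D
  val_E : ∀ r, val (E r) = toCoinv n (esym (others μ k) r)
  /-- The sign. -/
  u : PCoinv μ
  u_eq : u = algebraMap ℂ (PCoinv μ) (crossSign μ k)

namespace SplitModel

variable {μ : Comp n} {k : Fin n} {D : Type} [CommRing D] [Algebra (PCoinv μ) D]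
  (S : SplitModel μ k D)

/-- The factorization `∑_s e_s(μ;i) t^s = (1 + x_k t) ∑_r E_r t^r`. -/
def linearFactor : LinearFactor (PCoinv μ) D where
  x := S.x
  b := S.b
  F s := e μ s S.i
  E := S.E
  F_zero := e_zero μ S.i
  E_zero := S.val_injective (by rw [S.val_E, esym_zero, map_one, map_one])
  E_of_lt r hr := S.val_injective (by
    rw [S.val_E, esym_of_card_lt (S.card_others.trans_lt hr), map_zero, map_zero])
  algebraMap_F_succ s := S.val_injective (by
    rw [S.val_algebraMap, val_e, ← S.colour_k, ← insert_others, esym_insert (notMem_others μ k),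
      map_add, map_mul, map_add, map_mul, S.val_E, S.val_E, S.val_x])
  mem_span d := by
    obtain ⟨N, z, s, h⟩ := exists_eq_sum_val_mul_pow S.mem_G (S.val_mem d)
    have h2 : d = ∑ r ∈ Finset.range N, z r • S.x ^ s r := S.val_injective (by
      simp only [h, map_sum, Algebra.smul_def, map_mul, map_pow, S.val_algebraMap, S.val_x])
    rw [h2]
    exact Submodule.sum_mem _ fun r _ =>
      Submodule.smul_mem _ _ (Submodule.subset_span ⟨s r, rfl⟩)

/-- The linear form `D → C_μ`. -/
def form : D →ₗ[PCoinv μ] PCoinv μ where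
  toFun d := coinvForm μ k (S.val d)
  map_add' d d' := by rw [map_add, map_add]
  map_smul' z d := by
    rw [Algebra.smul_def, map_mul, S.val_algebraMap, coinvForm_val_mul, RingHom.id_apply,
      smul_eq_mul]

lemma form_apply (d : D) : S.form d = coinvForm μ k (S.val d) := rfl

lemma form_pow : ∀ j < S.b, S.form (S.x ^ j) = 0 := by
  intro j hj
  rw [form_apply, map_pow, S.val_x, coinvForm_pow (hj.trans_eq S.card_others.symm)]

lemma val_sum_E_mul_pow :
    S.val (∑ r ∈ Finset.range (S.b + 1), (-1) ^ r * S.E r * S.x ^ (S.b - r)) =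
      toCoinv n (cross μ k) := by
  have h := prod_sub_eq_sum_esym (others μ k) (toCoinv n).toRingHom (toCoinv n (MvPolynomial.X k))
  rw [cross, map_prod]
  simp only [map_sub]
  refine Eq.trans ?_ h.symm
  rw [S.card_others, map_sum]
  simp only [map_mul, map_pow, map_neg, map_one, S.val_E, S.val_x]
  rfl

/-- The form takes the value ±(b+1) on `cross`, because ∂_μ(ε_μ) = 1, and the value (b+1) θ(x^b) by
`form_sum_E_mul_pow`. So the leading value is found without computing an antisymmetrization. -/
lemma form_pow_b : S.form (S.x ^ S.b) = S.u := by
  have h1 := S.linearFactor.form_sum_E_mul_pow (θ := S.form) S.form_pow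
  have h2 : S.form (∑ r ∈ Finset.range (S.b + 1), (-1) ^ r * S.E r * S.x ^ (S.b - r)) =
      algebraMap ℂ (PCoinv μ) (crossSign μ k * (S.b + 1)) := by
    have h3 := coinvForm_cross_mul (k := k) (rfl : vandAway μ k = _) rfl (PCoinv.val μ 1)
    rw [coinvDivDiff_eps_mul, map_one, mul_one, S.card_others] at h3
    rw [form_apply, val_sum_E_mul_pow, h3, Algebra.smul_def, mul_one]
  have h4 : algebraMap ℂ (PCoinv μ) (crossSign μ k * (S.b + 1)) =
      ((S.b : PCoinv μ) + 1) * S.form (S.x ^ S.b) := h2.symm.trans h1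
  have h5 : (S.b + 1 : ℂ) ≠ 0 := by exact_mod_cast Nat.succ_ne_zero S.b
  have h6 := congrArg (algebraMap ℂ (PCoinv μ) (S.b + 1 : ℂ)⁻¹ * ·) h4
  rw [← map_mul, mul_comm (crossSign μ k), inv_mul_cancel_left₀ h5, ← mul_assoc,
    show ((S.b : PCoinv μ) + 1) = algebraMap ℂ (PCoinv μ) (S.b + 1 : ℂ) by simp, ← map_mul,
    inv_mul_cancel₀ h5, map_one, one_mul] at h6
  rw [← h6, S.u_eq]

lemma u_mul_u : S.u * S.u = 1 := by
  rw [S.u_eq, ← map_mul, crossSign_mul_self, map_one]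

lemma form_pow_eq (j : ℕ) : S.form (S.x ^ j) = S.u * h μ ((j : ℤ) - S.b) S.i := by
  rcases lt_or_ge j S.b with hj | hj
  · rw [S.form_pow j hj, h_of_neg μ (by omega), mul_zero]
  · obtain ⟨m, rfl⟩ := Nat.exists_eq_add_of_le hj
    have h1 := S.linearFactor.form_pow_add (θ := S.form) S.form_pow (H := fun m => h μ m S.i)
      (h_zero μ S.i) (sum_e_mul_h μ S.i) m
    rw [← S.form_pow_b, show ((S.b + m : ℕ) : ℤ) - S.b = m by push_cast; ring]
    exact h1

/-- The Frobenius system for `D` over `C_μ`. -/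
def frobeniusSystem : FrobeniusSystem (PCoinv μ) D :=
  S.linearFactor.frobeniusSystem S.form S.form_pow S.u S.form_pow_b S.u_mul_u

end SplitModel

lemma SplitModel.val_sum_left_mul_right {μ : Comp n} {k : Fin n} {D : Type} [CommRing D]
    [Algebra (PCoinv μ) D] (S : SplitModel μ k D) :
    S.val (∑ r ∈ Finset.range S.frobeniusSystem.size,
      S.frobeniusSystem.left r * S.frobeniusSystem.right r) =
      crossSign μ k • toCoinv n (cross μ k) := by
  have h : ∑ r ∈ Finset.range S.frobeniusSystem.size,
      S.frobeniusSystem.left r * S.frobeniusSystem.right r = algebraMap (PCoinv μ) D S.u *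
        ∑ r ∈ Finset.range (S.b + 1), (-1) ^ r * S.E r * S.x ^ (S.b - r) := by
    rw [Finset.mul_sum]
    exact Finset.sum_congr rfl fun r _ => mul_assoc (algebraMap (PCoinv μ) D S.u) _ _
  rw [h, map_mul, S.val_algebraMap, S.val_sum_E_mul_pow, S.u_eq, AlgHom.commutes, Algebra.smul_def]

/-- The trace map given by the Casimir element of one position model and the form of another. -/
lemma SplitModel.form_mul_sum {μ ρ : Comp n} {k : Fin n} {D : Type} [CommRing D]
    [Algebra (PCoinv μ) D] [Algebra (PCoinv ρ) D] (S : SplitModel ρ k D) (T : SplitModel μ k D)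
    (hval : T.val = S.val) (hv : vandAway ρ k = vandAway μ k) (hs : stabFin ρ k = stabFin μ k)
    (z : PCoinv ρ) :
    T.form (algebraMap (PCoinv ρ) D z * ∑ r ∈ Finset.range S.frobeniusSystem.size,
      S.frobeniusSystem.left r * S.frobeniusSystem.right r) =
      ((S.b : ℂ) + 1) • coinvDivDiff μ (eps ρ * PCoinv.val ρ z) := by
  -- The sign of the Casimir element meets the equal sign from `coinvForm_cross_mul`, so the trace
  -- carries no sign.
  rw [T.form_apply, hval, map_mul, S.val_algebraMap, S.val_sum_left_mul_right, mul_smul_comm,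
    map_smul, mul_comm, coinvForm_cross_mul hv hs, smul_smul, ← mul_assoc, crossSign_mul_self,
    one_mul, S.card_others]

/-! ### The two compositions of the key situation -/

namespace KeySituation

variable {ν ν' : Comp n} {i : ℤ} (hk : KeySituation ν ν' i)
include hk

lemma psum_gt {j : ℤ} (hj : i < j) : psum ν' j = psum ν j := by
  induction j, (show i + 1 ≤ j from hj) using Int.leInduction with
  | base => exact hk.psum_succ
  | succ j hj' ih =>
    rw [psum_eq_add ν, psum_eq_add ν', add_sub_cancel_right, ih (by omega), hk.apply,
      if_neg (by omega), if_neg (by omega)]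
    rfl

lemma colour_k : colour ν hk.k = i := ((hk.eq_k_iff hk.k).mp rfl).1

lemma colour_k' : colour ν' hk.k = i + 1 := ((hk.eq_k_iff hk.k).mp rfl).2

/-- Of all the partial sums only the i-th changes, dropping by one, and k is the position it loses.
-/
lemma colour_eq {p : Fin n} (hp : p ≠ hk.k) : colour ν' p = colour ν p := by
  obtain ⟨j, hj⟩ : ∃ j, colour ν p = j := ⟨_, rfl⟩
  rw [hj, colour_eq_iff]
  have h1 := (colour_eq_iff ν p j).mp hj
  have h2 : (p : ℕ) ≠ psum ν i - 1 := fun h => hp (Fin.ext h)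
  have h3 := hk.psum_self
  rcases lt_trichotomy j i with h | rfl | h
  · rwa [hk.psum_lt h, hk.psum_lt (by omega)]
  · rw [hk.psum_lt (by omega)]
    omega
  · rw [hk.psum_gt h]
    rcases eq_or_ne j (i + 1) with rfl | h'
    · rw [add_sub_cancel_right] at h1 ⊢
      omega
    · rwa [hk.psum_gt (by omega)]

lemma others_left : others ν hk.k = Finset.univ.filter fun p => colour ν' p = i := by
  ext p
  rw [mem_others, hk.colour_k, Finset.mem_filter]
  rcases eq_or_ne p hk.k with rfl | hp
  · simp [hk.colour_k']
  · simp [hp, hk.colour_eq hp]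

lemma others_right : others ν' hk.k = Finset.univ.filter fun p => colour ν p = i + 1 := by
  ext p
  rw [mem_others, hk.colour_k', Finset.mem_filter]
  rcases eq_or_ne p hk.k with rfl | hp
  · simp [hk.colour_k]
  · simp [hp, hk.colour_eq hp]

lemma vandAway_eq : vandAway ν' hk.k = vandAway ν hk.k := by
  refine Finset.prod_congr (Finset.filter_congr fun pq _ => and_congr_left fun h => ?_)
    fun _ _ => rfl
  rw [hk.colour_eq h.1, hk.colour_eq h.2]

/-- A permutation preserving both colourings fixes k, the only position with its pair of colours.
Conversely, away from k the two colourings agree. -/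
lemma mem_stabFin_iff (w : Equiv.Perm (Fin n)) :
    w ∈ parabolic ν ⊓ parabolic ν' ↔ w ∈ stabFin ν hk.k := by
  rw [mem_stabFin, mem_parFin_iff, Subgroup.mem_inf]
  refine and_congr_right fun hw => ⟨fun hw' => ?_, fun hw' p => ?_⟩
  · rw [hk.eq_k_iff, hw, hw']
    exact (hk.eq_k_iff _).mp rfl
  · rcases eq_or_ne p hk.k with rfl | hp
    · rw [hw']
    · rw [hk.colour_eq hp, hk.colour_eq, hw]
      exact fun h => hp (w.injective (h.trans hw'.symm))

lemma mem_stabFin_iff' (w : Equiv.Perm (Fin n)) :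
    w ∈ parabolic ν ⊓ parabolic ν' ↔ w ∈ stabFin ν' hk.k := by
  rw [mem_stabFin, mem_parFin_iff, Subgroup.mem_inf, and_comm]
  refine and_congr_right fun hw => ⟨fun hw' => ?_, fun hw' p => ?_⟩
  · rw [hk.eq_k_iff, hw, hw']
    exact (hk.eq_k_iff _).mp rfl
  · rcases eq_or_ne p hk.k with rfl | hp
    · rw [hw']
    · rw [← hk.colour_eq hp, ← hk.colour_eq, hw]
      exact fun h => hp (w.injective (h.trans hw'.symm))

lemma stabFin_eq : stabFin ν' hk.k = stabFin ν hk.k := by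
  ext w
  rw [← hk.mem_stabFin_iff, ← hk.mem_stabFin_iff']

/-- The position k is the last of its block in ν, so all a others precede it, whereas in ν' it is
the first of its block. This is why (-1)^a occurs in the first adjunction and no such sign in the
second. -/
lemma crossSign_left : crossSign ν hk.k = (-1) ^ ν'.1 i := by
  rw [crossSign, Finset.filter_true_of_mem, hk.others_left, card_colour]
  intro p hp
  rw [mem_others, hk.colour_k, colour_eq_iff] at hp
  have h1 : (p : ℕ) ≠ psum ν i - 1 := fun h => hp.1 (Fin.ext h)
  have h2 := hp.2.2
  change (p : ℕ) < psum ν i - 1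
  omega

lemma crossSign_right : crossSign ν' hk.k = 1 := by
  rw [crossSign, Finset.filter_false_of_mem, Finset.card_empty, pow_zero]
  intro p hp
  rw [mem_others, hk.colour_k', colour_eq_iff, add_sub_cancel_right, hk.psum_self] at hp
  have h2 := hp.2.1
  change ¬ (p : ℕ) < psum ν i - 1
  omega

end KeySituation

/-- The inclusion of `C_{ν,ν'}` into `C`. -/
def JCoinv.val (ν ν' : Comp n) : JCoinv ν ν' →ₐ[ℂ] Coinv n :=
  (inv (parabolic ν ⊓ parabolic ν')).val

namespace KeySituation

variable {ν ν' : Comp n} {i : ℤ} (hk : KeySituation ν ν' i)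

/-- `C_{ν,ν'}` over `C_ν`. -/
def leftModel : SplitModel ν hk.k (JCoinv ν ν') where
  G := parabolic ν ⊓ parabolic ν'
  mem_G := hk.mem_stabFin_iff
  val := (JCoinv.val ν ν').toRingHom
  val_injective := Subtype.val_injective
  val_algebraMap _ := rfl
  val_mem d := d.2
  x := hk.x
  val_x := rfl
  i := i
  colour_k := hk.colour_k
  b := ν'.1 i
  card_others := by rw [hk.others_left, card_colour]
  E r := algebraMap (PCoinv ν') (JCoinv ν ν') (e ν' r i)
  val_E r := by
    rw [hk.others_left]
    exact val_e ν' r i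
  u := (-1) ^ ν'.1 i
  u_eq := by rw [hk.crossSign_left]; simp

/-- `C_{ν,ν'}` over `C_{ν'}`. -/
def rightModel : SplitModel ν' hk.k (JCoinv ν ν') where
  G := parabolic ν ⊓ parabolic ν'
  mem_G := hk.mem_stabFin_iff'
  val := (JCoinv.val ν ν').toRingHom
  val_injective := Subtype.val_injective
  val_algebraMap _ := rfl
  val_mem d := d.2
  x := hk.x
  val_x := rfl
  i := i + 1
  colour_k := hk.colour_k'
  b := ν.1 (i + 1)
  card_others := by rw [hk.others_right, card_colour]
  E r := algebraMap (PCoinv ν) (JCoinv ν ν') (e ν r (i + 1))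
  val_E r := by
    rw [hk.others_right]
    exact val_e ν r (i + 1)
  u := 1
  u_eq := by rw [hk.crossSign_right, map_one]

/-- The adjunction between `C_{ν,ν'} ⊗ ?` and `C_{ν',ν} ⊗ ?`. -/
def firstAdjunction : toLeft ν ν' ⊣ toRight ν ν' :=
  hk.leftModel.frobeniusSystem.adjunction (PCoinv ν')

/-- The adjunction between `C_{ν',ν} ⊗ ?` and `C_{ν,ν'} ⊗ ?`. -/
def secondAdjunction : toRight ν ν' ⊣ toLeft ν ν' :=
  hk.rightModel.frobeniusSystem.adjunction (PCoinv ν)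

lemma isFirstAdjunction : IsFirstAdjunction hk hk.firstAdjunction where
  unit_apply M m := by
    refine (hk.leftModel.frobeniusSystem.adjunction_unit_app M m).trans ?_
    rw [Finset.smul_sum]
    refine Finset.sum_congr rfl fun r _ => ?_
    rw [TensorProduct.smul_tmul', TensorProduct.smul_tmul', Algebra.smul_def, Algebra.smul_def]
    change (algebraMap (PCoinv ν) (JCoinv ν ν') ((-1) ^ ν'.1 i) *
      ((-1) ^ r * algebraMap (PCoinv ν') (JCoinv ν ν') (e ν' r i))) ⊗ₜ[PCoinv ν] _ = _
    simp only [map_pow, map_neg, map_one]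
    rfl
  counit_apply M r s m := by
    refine (hk.leftModel.frobeniusSystem.adjunction_counit_app M _ _ m).trans ?_
    rw [← pow_add]
    have h1 := hk.leftModel.form_pow_eq (r + s)
    push_cast at h1
    exact congrArg (· • m) h1

lemma isSecondAdjunction : IsSecondAdjunction hk hk.secondAdjunction where
  unit_apply M m := by
    refine (hk.rightModel.frobeniusSystem.adjunction_unit_app M m).trans ?_
    refine Finset.sum_congr rfl fun r _ => ?_
    rw [TensorProduct.smul_tmul', Algebra.smul_def]
    change (algebraMap (PCoinv ν') (JCoinv ν ν') 1 *
      ((-1) ^ r * algebraMap (PCoinv ν) (JCoinv ν ν') (e ν r (i + 1)))) ⊗ₜ[PCoinv ν'] _ = _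
    simp only [map_pow, map_neg, map_one, one_mul]
    rfl
  counit_apply M r s m := by
    refine (hk.rightModel.frobeniusSystem.adjunction_counit_app M _ _ m).trans ?_
    rw [← pow_add]
    have h1 := (hk.rightModel.form_pow_eq (r + s)).trans (one_mul _)
    push_cast at h1
    exact congrArg (· • m) h1

/-- An adjunction between fixed functors is determined by its unit. -/
lemma isFirstAdjunction_unique {adj adj' : toLeft ν ν' ⊣ toRight ν ν'}
    (h : IsFirstAdjunction hk adj) (h' : IsFirstAdjunction hk adj') : adj = adj' := by
  refine Adjunction.ext (NatTrans.ext (funext fun M =>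
    FGModuleCat.hom_ext (LinearMap.ext fun m => ?_)))
  exact (h.unit_apply M m).trans (h'.unit_apply M m).symm

lemma isSecondAdjunction_unique {adj adj' : toRight ν ν' ⊣ toLeft ν ν'}
    (h : IsSecondAdjunction hk adj) (h' : IsSecondAdjunction hk adj') : adj = adj' := by
  refine Adjunction.ext (NatTrans.ext (funext fun M =>
    FGModuleCat.hom_ext (LinearMap.ext fun m => ?_)))
  exact (h.unit_apply M m).trans (h'.unit_apply M m).symm

lemma traceE_eq (z' : PCoinv ν') : traceE hk.firstAdjunction hk.secondAdjunction z' =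
    ((ν.1 (i + 1) : ℂ) + 1) • coinvDivDiff ν (eps ν' * PCoinv.val ν' z') :=
  (FrobeniusSystem.trace_adjunction hk.rightModel.frobeniusSystem hk.leftModel.frobeniusSystem
    z').trans (hk.rightModel.form_mul_sum hk.leftModel rfl hk.vandAway_eq hk.stabFin_eq z')

lemma traceF_eq (z : PCoinv ν) : traceF hk.firstAdjunction hk.secondAdjunction z =
    ((ν'.1 i : ℂ) + 1) • coinvDivDiff ν' (eps ν * PCoinv.val ν z) :=
  (FrobeniusSystem.trace_adjunction hk.leftModel.frobeniusSystem hk.rightModel.frobeniusSystem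
    z).trans (hk.leftModel.form_mul_sum hk.rightModel rfl hk.vandAway_eq.symm hk.stabFin_eq.symm z)

end KeySituation

/-! ### The action of the Chevalley generators -/

/-- A matrix unit that moves the colour of the position `k` in `μ` to its colour in `ρ`. -/
lemma schurRep_pureVec {μ ρ : Comp n} {k : Fin n}
    (hcol : ∀ p, p ≠ k → colour ρ p = colour μ p) {X : glInf}
    (hX : X.1 = unit (colour ρ k) (colour μ k)) (z : PCoinv μ) :
    schurRep n X (pureVec (colour μ) (eps μ * PCoinv.val μ z)) =
      (((others μ k).card : ℂ) + 1) • pureVec (colour ρ) (eps μ * PCoinv.val μ z) := by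
  set c := eps μ * PCoinv.val μ z with hc
  have h1 : schurRep n X (pureVec (colour μ) c) = ∑ p, (relations n).mkQ
      (PiTensorProduct.tprod ℂ (Function.update (fun q => v (colour μ q)) p
        (X.1 (v (colour μ p)))) ⊗ₜ[ℂ] c) := by
    change (relations n).mkQ ((∑ p, actAt p X.1) _ ⊗ₜ[ℂ] c) = _
    simp only [LinearMap.sum_apply, actAt_tprod, TensorProduct.sum_tmul, map_sum]
  have h2 : ∀ p, (relations n).mkQ
      (PiTensorProduct.tprod ℂ (Function.update (fun q => v (colour μ q)) p
        (X.1 (v (colour μ p)))) ⊗ₜ[ℂ] c) =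
      if colour μ p = colour μ k then pureVec (colour ρ) c else 0 := by
    intro p
    rw [hX, unit_v]
    split_ifs with hp
    -- Recolouring p instead of k gives the colours of ρ composed with the swap of p and k. This
    -- swap lies in S_μ, so moving it across the tensor sign leaves ε_μ z unchanged.
    · have h3 : (Function.update (fun q => v (colour μ q)) p (v (colour ρ k))) =
          fun q => v ((colour ρ ∘ (Equiv.swap p k : Equiv.Perm (Fin n))) q) := by
        funext q
        rw [Function.comp_apply]
        rcases eq_or_ne q p with rfl | hqp
        · rw [Function.update_self, Equiv.swap_apply_left]
        · rw [Function.update_of_ne hqp]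
          rcases eq_or_ne q k with rfl | hqk
          · rw [Equiv.swap_apply_right, hcol p hqp.symm, hp]
          · rw [Equiv.swap_apply_of_ne_of_ne hqp hqk, hcol q hqk]
      rw [h3]
      refine (pureVec_comp (colour ρ) (Equiv.swap p k) c).trans ?_
      rw [hc, twist_eps_mul z (swap_mem_parFin hp)]
    · have h3 : PiTensorProduct.tprod ℂ (Function.update (fun q => v (colour μ q)) p 0) = 0 :=
        (PiTensorProduct.tprod ℂ).map_update_zero _ _
      rw [h3, TensorProduct.zero_tmul, map_zero]
  rw [h1, Finset.sum_congr rfl fun p _ => h2 p, ← Finset.sum_filter, Finset.sum_const,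
    ← insert_others, Finset.card_insert_of_notMem (notMem_others μ k), ← Nat.cast_smul_eq_nsmul ℂ]
  push_cast
  rfl

/-- The Lie-theoretic counterpart of `traceE_eq` and `traceF_eq`: the scalar now counts the
positions that can be recoloured. -/
lemma coinvRep_lof (hφ : Function.Bijective (phiInv n)) {μ ρ : Comp n} {k : Fin n}
    (hcol : ∀ p, p ≠ k → colour ρ p = colour μ p) {X : glInf}
    (hX : X.1 = unit (colour ρ k) (colour μ k)) (z : PCoinv μ) :
    coinvRep hφ X (DirectSum.lof ℂ (Comp n) PCoinv μ z) =
      DirectSum.lof ℂ (Comp n) PCoinv ρ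
        ((((others μ k).card : ℂ) + 1) • coinvDivDiff ρ (eps μ * PCoinv.val μ z)) := by
  have h : coinvRep hφ X (DirectSum.lof ℂ (Comp n) PCoinv μ z) =
      (LinearEquiv.ofBijective (phiInv n) hφ).symm
        (schurRep n X (phiInv n (DirectSum.lof ℂ (Comp n) PCoinv μ z))) := rfl
  rw [h, LinearEquiv.symm_apply_eq, phiInv_lof, schurRep_pureVec hcol hX, pureVec_colour, map_smul]
  exact (map_smul (phiInv n) _ _).symm

end TraceMaps

end

open TraceMaps in
theorem mainTheorem5 (n : ℕ) (ν ν' : Comp n) (i : ℤ) (hk : KeySituation ν ν' i) :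
    ∃ hφ : Function.Bijective (phiInv n),
      (∃! adj₁ : toLeft ν ν' ⊣ toRight ν ν', IsFirstAdjunction hk adj₁) ∧
      (∃! adj₂ : toRight ν ν' ⊣ toLeft ν ν', IsSecondAdjunction hk adj₂) ∧
      ∀ (adj₁ : toLeft ν ν' ⊣ toRight ν ν') (adj₂ : toRight ν ν' ⊣ toLeft ν ν'),
        IsFirstAdjunction hk adj₁ → IsSecondAdjunction hk adj₂ →
          (∀ z' : PCoinv ν', DirectSum.lof ℂ (Comp n) PCoinv ν (traceE adj₁ adj₂ z') =
            coinvRep hφ (chevE i) (DirectSum.lof ℂ (Comp n) PCoinv ν' z')) ∧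
          (∀ z : PCoinv ν, DirectSum.lof ℂ (Comp n) PCoinv ν' (traceF adj₁ adj₂ z) =
            coinvRep hφ (chevF i) (DirectSum.lof ℂ (Comp n) PCoinv ν z)) := by
  refine ⟨phiInv_bijective n, ⟨hk.firstAdjunction, hk.isFirstAdjunction,
    fun adj h => hk.isFirstAdjunction_unique h hk.isFirstAdjunction⟩,
    ⟨hk.secondAdjunction, hk.isSecondAdjunction,
    fun adj h => hk.isSecondAdjunction_unique h hk.isSecondAdjunction⟩, ?_⟩
  intro adj₁ adj₂ h₁ h₂
  -- By uniqueness, the given adjunctions are those built from the Frobenius systems.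
  obtain rfl := hk.isFirstAdjunction_unique h₁ hk.isFirstAdjunction
  obtain rfl := hk.isSecondAdjunction_unique h₂ hk.isSecondAdjunction
  refine ⟨fun z' => ?_, fun z => ?_⟩
  · rw [hk.traceE_eq, coinvRep_lof _ (fun p hp => (hk.colour_eq hp).symm) (k := hk.k),
      hk.rightModel.card_others]
    · rfl
    · rw [hk.colour_k, hk.colour_k']
      rfl
  · rw [hk.traceF_eq, coinvRep_lof _ (fun p hp => hk.colour_eq hp) (k := hk.k),
      hk.leftModel.card_others]
    · rfl
    · rw [hk.colour_k, hk.colour_k']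
      rfl
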